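/- Let $n,m,d\ge 0$ be integers and $t_0<T$. Let $F\in L^1([t_0,T];\mathcal L(\mathbb R^n))$, $G\in L^2([t_0,T];\mathcal L(\mathbb R^d,\mathbb R^n))$, $H\in L^2([t_0,T];\mathcal L(\mathbb R^n,\mathbb R^m))$, $Q\in L^1([t_0,T];\mathcal L(\mathbb R^d))$ and $R\in L^2([t_0,T];\mathcal L(\mathbb R^m))$, with $GQG^*\in L^1$, where $Q(t)$ is symmetric positive semidefinite and $R(t)$ is symmetric with $R(t)\succcurlyeq r\,\mathrm{Id}$ for a.e. $t$, for some constant $r>0$. Let $\Pi_0,\Sigma_T\in\mathcal L(\mathbb R^n)$ be symmetric positive semidefinite. Let $S_\Lambda$ be the set of functions $\lambda:[t_0,T]\to\mathbb R^n$ for which there are $z\in\mathbb R^n$ and $v\in L^2(t_0,T;\mathbb R^m)$ with $\int_{t_0}^T\langle R(t)v(t),v(t)\rangle\,dt<\infty$ such that $\lambda$ is absolutely continuous and $$-\dot\lambda(t)=F^*(t)\lambda(t)+H^*(t)v(t)\ \text{ for a.e. } t,\qquad \lambda(T)=\Sigma_T^{1/2}z .$$ A representative of $\lambda\in S_\Lambda$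 is such a pair $(z,v)$ that minimizes $\|z\|^2+\int_{t_0}^T\langle R v,v\rangle\,dt$ among all pairs that generate $\lambda$. **Theorem.** 1. Every $\lambda\in S_\Lambda$ has a representative, and it is unique ($v$ up to a.e. equality). 2. $S_\Lambda$, with pointwise operations and the inner product $$\langle\lambda_1,\lambda_2\rangle_{S_\Lambda}=\langle\Pi_0\lambda_1(t_0),\lambda_2(t_0)\rangle+\langle z_1,z_2\rangle+\int_{t_0}^T\langle G Q G^*\lambda_1,\lambda_2\rangle\,dt+\int_{t_0}^T\langle R v_1,v_2\rangle\,dt ,$$ where $(z_i,v_i)$ is the representative of $\lambda_i$, is a Hilbert space of $\mathbb R^n$-valued functions on $[t_0,T]$ with continuous point evaluations, that is, a vector-valued reproducing kernel Hilbert space. Its squared norm is the cost $J_\lambda(z,v)=\langle\Pi_0\lambda(t_0),\lambda(t_0)\rangle+\|z\|^2+\int_{t_0}^T\langle GQG^*\lambda,\lambda\rangle\,dt+\int_{t_0}^T\langle Rv,v\rangle\,dt$ at the representative $(z,v)$ of $\lambda$. 3. The Riccati equation $\dot\Pi=F\Pi+\Pi F^*-\Pi H^*R^{-1}H\Pi+GQG^*$,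 $\Pi(t_0)=\Pi_0$, has an absolutely continuous solution on all of $[t_0,T]$. For every such solution $\Pi$, the evolution family $\Phi_{F,\Pi}$ of $F-\Pi H^*R^{-1}H$, that is $\partial_s\Phi_{F,\Pi}(s,t)=(F(s)-\Pi(s)H^*(s)R^{-1}(s)H(s))\Phi_{F,\Pi}(s,t)$, $\Phi_{F,\Pi}(t,t)=\mathrm{Id}$, exists, the operator $\mathrm{Id}+\Sigma_T^{1/2}\Pi(T)\Sigma_T^{1/2}$ is invertible, and the reproducing kernel of $S_\Lambda$ is $$\Lambda(s,t|T)=\Phi_{F,\Pi}^*(T,s)\,\Sigma_T^{1/2}\bigl(\mathrm{Id}+\Sigma_T^{1/2}\Pi(T)\Sigma_T^{1/2}\bigr)^{-1}\Sigma_T^{1/2}\,\Phi_{F,\Pi}(T,t)+\int_{\max(s,t)}^T\Phi_{F,\Pi}^*(\tau,s)H^*(\tau)R^{-1}(\tau)H(\tau)\Phi_{F,\Pi}(\tau,t)\,d\tau .$$ This means that for all $t\in[t_0,T]$ and $p\in\mathbb R^n$, $\Lambda(\cdot,t|T)p\in S_\Lambda$ and $\langle\lambda,\Lambda(\cdot,t|T)p\rangle_{S_\Lambda}=\langle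 p,\lambda(t)\rangle$ for all $\lambda\in S_\Lambda$. 4. If moreover $F\in L^2$ and $H\in L^\infty$, then $S_\Lambda\subset H^1(t_0,T;\mathbb R^n)$. -/

import Mathlib

open MeasureTheory Set
open scoped InnerProductSpace InnerProduct MatrixOrder ENNReal

noncomputable section

/-- The Euclidean space `ℝᵏ`. -/
abbrev Euc (k : ℕ) : Type := EuclideanSpace ℝ (Fin k)

/-- The positive semidefinite square root of a positive semidefinite operator on `ℝⁿ`
(computed on the matrix of the operator in the standard basis). -/
def psdSqrt {n : ℕ} (A : Euc n →L[ℝ] Euc n) : Euc n →L[ℝ] Euc n :=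
  Matrix.toEuclideanCLM (n := Fin n) (𝕜 := ℝ)
    (CFC.sqrt ((Matrix.toEuclideanCLM (n := Fin n) (𝕜 := ℝ)).symm A))

/-- The data of a time-varying linear estimation problem on `[t₀, T]`: state operator `F`,
noise input operator `G`, observation operator `H`, noise covariances `Q` and `R`, and the
weights `P₀` (for `Π₀`, at the initial time) and `ST` (for `Σ_T`, at the final time).
Only the values of the functions on `[t₀, T]` matter. -/
structure LinearSystem (n m d : ℕ) where
  t₀ : ℝ
  T : ℝ
  t₀_lt_T : t₀ < T
  F : ℝ → Euc n →L[ℝ] Euc n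
  G : ℝ → Euc d →L[ℝ] Euc n
  H : ℝ → Euc n →L[ℝ] Euc m
  Q : ℝ → Euc d →L[ℝ] Euc d
  R : ℝ → Euc m →L[ℝ] Euc m
  P₀ : Euc n →L[ℝ] Euc n
  ST : Euc n →L[ℝ] Euc n

namespace LinearSystem

variable {n m d : ℕ} (D : LinearSystem n m d)

/-- The time interval `[t₀, T]`, as a type. -/
abbrev Time : Type := Icc D.t₀ D.T

/-- Lebesgue measure on `[t₀, T]`. -/
abbrev vol : Measure ℝ := volume.restrict (Icc D.t₀ D.T)

/-- The initial time, as an element of the time interval. -/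
def start : D.Time := ⟨D.t₀, left_mem_Icc.2 D.t₀_lt_T.le⟩

/-- The operator `G(t) Q(t) G(t)*`. -/
def GQG (t : ℝ) : Euc n →L[ℝ] Euc n := D.G t ∘L D.Q t ∘L (D.G t)†

/-- The operator `H(t)* R(t)⁻¹ H(t)`. -/
def HRH (t : ℝ) : Euc n →L[ℝ] Euc n := (D.H t)† ∘L Ring.inverse (D.R t) ∘L D.H t

/-- The standing assumptions: `F ∈ L¹`, `G ∈ L²`, `H ∈ L²`, `Q ∈ L¹`, `R ∈ L²`, `G Q G* ∈ L¹`;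
`Π₀`, `Σ_T` and almost every `Q(t)` are (symmetric) positive semidefinite, and for some
`r > 0`, `R(t)` is symmetric with `R(t) ≽ r Id` for almost every `t`. -/
structure Admissible : Prop where
  F_mem : MemLp D.F 1 D.vol
  G_mem : MemLp D.G 2 D.vol
  H_mem : MemLp D.H 2 D.vol
  Q_mem : MemLp D.Q 1 D.vol
  R_mem : MemLp D.R 2 D.vol
  GQG_mem : MemLp D.GQG 1 D.vol
  P₀_pos : D.P₀.IsPositive
  ST_pos : D.ST.IsPositive
  Q_pos : ∀ᵐ t ∂D.vol, (D.Q t).IsPositive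
  R_coercive : ∃ r : ℝ, 0 < r ∧
    ∀ᵐ t ∂D.vol, (D.R t - r • ContinuousLinearMap.id ℝ (Euc m)).IsPositive

/-! ### The space of information vectors -/

/-- `(z, v)` generates the function `l` on `[t₀, T]`: `v ∈ L²` with `R^{1/2} v ∈ L²`, and `l` is
the (absolutely continuous) solution of `-l' = F* l + H* v`, `l(T) = Σ_T^{1/2} z`. -/
structure Generates (z : Euc n) (v : ℝ → Euc m) (l : D.Time → Euc n) : Prop where
  control_mem : MemLp v 2 D.vol
  control_cost : Integrable (fun t => ⟪D.R t (v t), v t⟫_ℝ) D.vol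
  continuous : Continuous l
  equation : ∀ t : D.Time, l t = psdSqrt D.ST z +
    ∫ τ in (t : ℝ)..D.T, (((D.F τ)†) (IccExtend D.t₀_lt_T.le l τ) + ((D.H τ)†) (v τ))

/-- The set of information vectors, as a bare type. -/
structure InfoVector where
  toFun : D.Time → Euc n
  exists_generates : ∃ z v, D.Generates z v toFun

/-- The part `‖z‖² + ∫ ⟨R v, v⟩` of the cost that is carried by the control `(z, v)`. -/
def controlCost (z : Euc n) (v : ℝ → Euc m) : ℝ :=
  ‖z‖ ^ 2 + ∫ t, ⟪D.R t (v t), v t⟫_ℝ ∂D.vol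

/-- `(z, v)` is a representative of `l`: it generates `l`, with minimal control cost. -/
def IsRepresentative (z : Euc n) (v : ℝ → Euc m) (l : D.Time → Euc n) : Prop :=
  D.Generates z v l ∧ ∀ z' v', D.Generates z' v' l → D.controlCost z v ≤ D.controlCost z' v'

/-- The bilinear form whose diagonal is the cost
`J(z, v) = ⟨Π₀ l(t₀), l(t₀)⟩ + ‖z‖² + ∫ ⟨G Q G* l, l⟩ + ∫ ⟨R v, v⟩`. -/
def costForm (l₁ : D.Time → Euc n) (z₁ : Euc n) (v₁ : ℝ → Euc m)
    (l₂ : D.Time → Euc n) (z₂ : Euc n) (v₂ : ℝ → Euc m) : ℝ :=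
  ⟪D.P₀ (l₁ D.start), l₂ D.start⟫_ℝ + ⟪z₁, z₂⟫_ℝ
    + (∫ t, ⟪D.GQG t (IccExtend D.t₀_lt_T.le l₁ t), IccExtend D.t₀_lt_T.le l₂ t⟫_ℝ ∂D.vol)
    + ∫ t, ⟪D.R t (v₁ t), v₂ t⟫_ℝ ∂D.vol

/-- `l ∈ H¹(t₀, T; ℝⁿ)`: `l` is a primitive of a function in `L²`. -/
def MemH1 (l : D.Time → Euc n) : Prop :=
  ∃ g : ℝ → Euc n, MemLp g 2 D.vol ∧
    ∀ t : D.Time, l t = l D.start + ∫ τ in D.t₀..(t : ℝ), g τ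

/-! ### The kernel -/

/-- `P` (for `Π`) is a (Carathéodory) solution on `[t₀, T]` of the Riccati equation
`Π' = F Π + Π F* - Π H* R⁻¹ H Π + G Q G*`, `Π(t₀) = Π₀`. -/
def IsRiccatiSolution (P : ℝ → Euc n →L[ℝ] Euc n) : Prop :=
  ContinuousOn P (Icc D.t₀ D.T) ∧
  ∀ t ∈ Icc D.t₀ D.T, P t = D.P₀ + ∫ τ in D.t₀..t,
    (D.F τ ∘L P τ + P τ ∘L (D.F τ)† - P τ ∘L D.HRH τ ∘L P τ + D.GQG τ)

/-- `Φ` is the evolution family of `F - Π H* R⁻¹ H` on `[t₀, T]`: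
`∂Φ/∂s (s, t) = (F(s) - Π(s) H(s)* R(s)⁻¹ H(s)) Φ(s, t)` and `Φ(t, t) = Id`. -/
def IsEvolution (P : ℝ → Euc n →L[ℝ] Euc n) (Φ : ℝ → ℝ → Euc n →L[ℝ] Euc n) : Prop :=
  ∀ t ∈ Icc D.t₀ D.T, ContinuousOn (fun s => Φ s t) (Icc D.t₀ D.T) ∧
    ∀ s ∈ Icc D.t₀ D.T, Φ s t = ContinuousLinearMap.id ℝ (Euc n) +
      ∫ τ in t..s, (D.F τ - P τ ∘L D.HRH τ) ∘L Φ τ t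

/-- The operator `Id + Σ_T^{1/2} Π(T) Σ_T^{1/2}`. -/
def middle (P : ℝ → Euc n →L[ℝ] Euc n) : Euc n →L[ℝ] Euc n :=
  ContinuousLinearMap.id ℝ (Euc n) + psdSqrt D.ST ∘L P D.T ∘L psdSqrt D.ST

/-- The kernel `Λ(s, t | T)`, written in terms of `Π` and of the evolution family `Φ`. -/
def infoKernel (P : ℝ → Euc n →L[ℝ] Euc n) (Φ : ℝ → ℝ → Euc n →L[ℝ] Euc n) (s t : ℝ) :
    Euc n →L[ℝ] Euc n :=
  (Φ D.T s)† ∘L psdSqrt D.ST ∘L Ring.inverse (D.middle P) ∘L psdSqrt D.ST ∘L Φ D.T t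
    + ∫ τ in (max s t)..D.T, (Φ τ s)† ∘L D.HRH τ ∘L Φ τ t

end LinearSystem

end

/-! Put `w = R^{1/2} v`. The pairs `(z, w)` form a Hilbert space, `ControlSpace`, with squared norm
`‖z‖² + ∫ ⟨R v, v⟩`. Solving the adjoint equation backwards from `T` defines a linear map `Λ` from
it to functions on `[t₀, T]`, bounded uniformly in time (`exists_stateMap`), and the information
vectors are the range of `Λ`. The cheapest pairs generating a given function are exactly the
elements of `(ker Λ)ᗮ`, so representatives come from orthogonal projection and the range inherits
the Hilbert structure of `(ker Λ)ᗮ`. The terms in `Π₀` and `G Q G*` add a bounded nonnegative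
symmetric form, which only changes the norm to an equivalent one
(`exists_hilbert_structure_of_equiv`).

The Riccati equation is linearised by its Hamiltonian system: `Π = X Y⁻¹`, and `Y` stays invertible
because the weights are positive (`hamiltonian_isUnit`). Every solution is symmetric and nonnegative
at `T`, which makes the middle factor of the kernel invertible.

The kernel formula expresses optimality conditions. The section `l` at `t` in direction `p` has a
costate `ξ` with `ξ' = F ξ - G Q G* l`, `ξ(t₀) = -Π₀ l(t₀)` when `t₀ < t`, and a jump `p` at `t`;
its control is `v = R⁻¹ H ξ`, `z = Σ_T^{1/2} ξ(T)`, where `ξ(T)` includes the jump even when `t =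
T`. The Riccati equation decouples the system: `ξ(s) = 1_{t<s} Φ(s, t) p - Π(s) l(s)`. Integrating
the derivative of `⟨ξ, q⟩` for an arbitrary information vector `q` gives the reproducing identity
(`kernelSection_pairing`, `exists_kernel_control`). Applied to controls that generate `0`, the same
identity puts the control of `l` in `(ker Λ)ᗮ`, so it is the representative.

The coefficients are merely integrable, so all differential equations are handled through
`IsPrimitiveOn`. -/

noncomputable section

/-! ### Calculus of primitives of integrable functions. -/

section Calculus

variable {E F G : Type*} [NormedAddCommGroup E] [NormedSpace ℝ E]
  [NormedAddCommGroup F] [NormedSpace ℝ F] [NormedAddCommGroup G] [NormedSpace ℝ G]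

theorem intervalIntegral_eq_integral_indicator_Iic (k : ℝ → E) {a b s : ℝ} (hs : s ∈ Ioc a b) :
    ∫ τ in a..s, k τ = ∫ τ in Ioc a b, (Iic s).indicator k τ := by
  rw [intervalIntegral.integral_of_le hs.1.le, integral_indicator measurableSet_Iic,
    Measure.restrict_restrict measurableSet_Iic]
  congr 2
  ext x
  simp only [mem_Ioc, mem_inter_iff, mem_Iic]
  constructor
  · rintro ⟨h1, h2⟩; exact ⟨h2, h1, h2.trans hs.2⟩
  · rintro ⟨h1, h2, h3⟩; exact ⟨h2, h1⟩

/-- Integration by parts for primitives of integrable functions, from zero initial values. -/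
theorem integral_bilin_primitive [CompleteSpace E] [CompleteSpace F] [CompleteSpace G]
    (B : E →L[ℝ] F →L[ℝ] G) {f : ℝ → E} {g : ℝ → F} {a b : ℝ}
    (hf : IntegrableOn f (Ioc a b)) (hg : IntegrableOn g (Ioc a b)) :
    (∫ s in Ioc a b, B (f s) (∫ τ in a..s, g τ)) + ∫ s in Ioc a b, B (∫ τ in a..s, f τ) (g s)
      = B (∫ s in Ioc a b, f s) (∫ s in Ioc a b, g s) := by
  set μ := (volume : Measure ℝ).restrict (Ioc a b) with hμ
  have hint : Integrable (fun p : ℝ × ℝ => B (f p.1) (g p.2)) (μ.prod μ) := by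
    have := Integrable.op_fst_snd (op := fun x y => B x y) (μ := μ) (ν := μ) (f := f) (g := g)
      (by fun_prop) ⟨‖B‖, fun x y => B.le_opNorm₂ x y⟩ hf hg
    exact this
  have h1 : MeasurableSet {p : ℝ × ℝ | p.2 ≤ p.1} := measurableSet_le measurable_snd measurable_fst
  have h2 : MeasurableSet {p : ℝ × ℝ | p.1 ≤ p.2} := measurableSet_le measurable_fst measurable_snd
  -- By Fubini, the two terms are integrals of the same function over the two triangles cut from the
  -- square by its diagonal, a null set.
  have e1 : ∫ s in Ioc a b, B (f s) (∫ τ in a..s, g τ)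
      = ∫ p, {p : ℝ × ℝ | p.2 ≤ p.1}.indicator (fun p => B (f p.1) (g p.2)) p ∂(μ.prod μ) := by
    rw [integral_prod _ (hint.indicator h1)]
    refine setIntegral_congr_fun measurableSet_Ioc fun s hs => ?_
    rw [intervalIntegral_eq_integral_indicator_Iic g hs, ← ContinuousLinearMap.integral_comp_comm _ (hg.indicator measurableSet_Iic)]
    refine integral_congr_ae (.of_forall fun τ => ?_)
    by_cases h : τ ≤ s <;> simp [indicator, h]
  have e2 : ∫ s in Ioc a b, B (∫ τ in a..s, f τ) (g s)
      = ∫ p, {p : ℝ × ℝ | p.1 ≤ p.2}.indicator (fun p => B (f p.1) (g p.2)) p ∂(μ.prod μ) := by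
    rw [integral_prod_symm _ (hint.indicator h2)]
    refine setIntegral_congr_fun measurableSet_Ioc fun s hs => ?_
    rw [intervalIntegral_eq_integral_indicator_Iic f hs, ← ContinuousLinearMap.flip_apply,
      ← ContinuousLinearMap.integral_comp_comm _ (hf.indicator measurableSet_Iic)]
    refine integral_congr_ae (.of_forall fun τ => ?_)
    by_cases h : τ ≤ s <;> simp [indicator, h]
  have hdiag : ∀ᵐ p : ℝ × ℝ ∂(μ.prod μ), p.1 ≠ p.2 := by
    have hm : MeasurableSet {p : ℝ × ℝ | p.1 ≠ p.2} :=
      (measurableSet_eq_fun measurable_fst measurable_snd).compl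
    rw [Measure.ae_prod_iff_ae_ae hm]
    refine .of_forall fun x => ?_
    have : ∀ᵐ y ∂μ, y ≠ x := by
      rw [hμ]; exact ae_restrict_of_ae (Measure.ae_ne volume x)
    filter_upwards [this] with y hy using hy.symm
  rw [e1, e2, ← integral_add (hint.indicator h1) (hint.indicator h2)]
  have e3 : B (∫ s in Ioc a b, f s) (∫ s in Ioc a b, g s)
      = ∫ p, B (f p.1) (g p.2) ∂(μ.prod μ) := by
    rw [integral_prod _ hint, ← ContinuousLinearMap.flip_apply,
      ← ContinuousLinearMap.integral_comp_comm _ hf]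
    refine integral_congr_ae (.of_forall fun s => ?_)
    simp only [ContinuousLinearMap.flip_apply]
    rw [← ContinuousLinearMap.integral_comp_comm _ hg]
  rw [e3]
  refine integral_congr_ae ?_
  filter_upwards [hdiag] with p hp
  rcases lt_or_gt_of_ne hp with h | h
  · simp [indicator, h.le, not_le.2 h]
  · simp [indicator, h.le, not_le.2 h]

/-- `f` is, on `[a, b]`, a primitive of the integrable function `f'`. -/
structure IsPrimitiveOn (f f' : ℝ → E) (a b : ℝ) : Prop where
  integrableOn : IntegrableOn f' (Icc a b)
  eq_add : ∀ t ∈ Icc a b, f t = f a + ∫ τ in a..t, f' τ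

omit [NormedSpace ℝ E] in
theorem MeasureTheory.IntegrableOn.intervalIntegrable_of_mem {f' : ℝ → E} {a b s t : ℝ}
    (h : IntegrableOn f' (Icc a b)) (hs : s ∈ Icc a b) (ht : t ∈ Icc a b) :
    IntervalIntegrable f' volume s t := by
  rw [intervalIntegrable_iff]
  refine h.mono_set (uIoc_subset_uIcc.trans ?_)
  exact uIcc_subset_Icc hs ht

namespace IsPrimitiveOn

variable {f f' : ℝ → E} {g g' : ℝ → F} {a b c : ℝ}

theorem sub_eq (h : IsPrimitiveOn f f' a b) {s t : ℝ} (hs : s ∈ Icc a b) (ht : t ∈ Icc a b) :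
    f t - f s = ∫ τ in s..t, f' τ := by
  have hab : a ∈ Icc a b := left_mem_Icc.2 (hs.1.trans hs.2)
  rw [h.eq_add t ht, h.eq_add s hs, add_sub_add_left_eq_sub]
  exact intervalIntegral.integral_interval_sub_left
    (h.integrableOn.intervalIntegrable_of_mem hab ht)
    (h.integrableOn.intervalIntegrable_of_mem hab hs)

/-- The base point `c` is arbitrary so that equations with terminal data, such as those in
`Generates`, fit the same predicate. -/
theorem of_eq_add {x : E} (hf' : IntegrableOn f' (Icc a b)) (hc : c ∈ Icc a b)
    (h : ∀ t ∈ Icc a b, f t = x + ∫ τ in c..t, f' τ) : IsPrimitiveOn f f' a b := by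
  have hab : a ∈ Icc a b := left_mem_Icc.2 (hc.1.trans hc.2)
  refine ⟨hf', fun t ht => ?_⟩
  rw [h t ht, h a hab, add_assoc, intervalIntegral.integral_add_adjacent_intervals
    (hf'.intervalIntegrable_of_mem hc hab) (hf'.intervalIntegrable_of_mem hab ht)]

theorem continuousOn (h : IsPrimitiveOn f f' a b) : ContinuousOn f (Icc a b) := by
  have h1 : ContinuousOn (fun t => f a + ∫ τ in a..t, f' τ) (Icc a b) :=
    continuousOn_const.add (intervalIntegral.continuousOn_primitive h.integrableOn |>.congr
      fun t ht => intervalIntegral.integral_of_le ht.1)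
  exact h1.congr h.eq_add

theorem mono (h : IsPrimitiveOn f f' a b) {a' b' : ℝ} (ha : a ≤ a') (hb : b' ≤ b) :
    IsPrimitiveOn f f' a' b' := by
  refine ⟨h.integrableOn.mono_set (Icc_subset_Icc ha hb), fun t ht => ?_⟩
  have := h.sub_eq (s := a') (t := t) ⟨ha, (ht.1.trans ht.2).trans hb⟩
    ⟨ha.trans ht.1, ht.2.trans hb⟩
  rw [← this]; abel

theorem trans (hab : a ≤ b) (hbc : b ≤ c) (h₁ : IsPrimitiveOn f f' a b)
    (h₂ : IsPrimitiveOn f f' b c) : IsPrimitiveOn f f' a c := by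
  have hint : IntegrableOn f' (Icc a c) := by
    rw [← Icc_union_Icc_eq_Icc hab hbc]; exact h₁.integrableOn.union h₂.integrableOn
  refine ⟨hint, fun t ht => ?_⟩
  rcases le_total t b with h | h
  · exact h₁.eq_add t ⟨ht.1, h⟩
  · rw [h₂.eq_add t ⟨h, ht.2⟩, h₁.eq_add b ⟨hab, le_rfl⟩, add_assoc,
      intervalIntegral.integral_add_adjacent_intervals]
    · exact hint.intervalIntegrable_of_mem ⟨le_rfl, hab.trans hbc⟩ ⟨hab, hbc⟩
    · exact hint.intervalIntegrable_of_mem ⟨hab, hbc⟩ ht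

theorem congr_ae (h : IsPrimitiveOn f f' a b) {k : ℝ → E}
    (hk : f' =ᵐ[volume.restrict (Icc a b)] k) : IsPrimitiveOn f k a b := by
  refine ⟨h.integrableOn.congr hk, fun t ht => ?_⟩
  rw [h.eq_add t ht]
  congr 1
  refine intervalIntegral.integral_congr_ae ?_
  rw [uIoc_of_le ht.1]
  have := (ae_restrict_iff' measurableSet_Icc).1 hk
  filter_upwards [this] with x hx hxt using hx ⟨hxt.1.le, hxt.2.trans ht.2⟩

theorem congr (h : IsPrimitiveOn f f' a b) {k : ℝ → E} (hk : EqOn k f (Icc a b)) :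
    IsPrimitiveOn k f' a b := by
  refine ⟨h.integrableOn, fun t ht => ?_⟩
  rw [hk ht, hk ⟨le_rfl, ht.1.trans ht.2⟩, h.eq_add t ht]

theorem congr_deriv (h : IsPrimitiveOn f f' a b) {k : ℝ → E}
    (hk : ∀ t, f' t = k t) : IsPrimitiveOn f k a b :=
  h.congr_ae (.of_forall hk)

theorem add (h : IsPrimitiveOn f f' a b) {k k' : ℝ → E} (hk : IsPrimitiveOn k k' a b) :
    IsPrimitiveOn (fun t => f t + k t) (fun t => f' t + k' t) a b := by
  refine ⟨h.integrableOn.add hk.integrableOn, fun t ht => ?_⟩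
  have hab : a ∈ Icc a b := left_mem_Icc.2 (ht.1.trans ht.2)
  rw [intervalIntegral.integral_add (h.integrableOn.intervalIntegrable_of_mem hab ht)
    (hk.integrableOn.intervalIntegrable_of_mem hab ht), h.eq_add t ht, hk.eq_add t ht]
  abel

variable [CompleteSpace E] [CompleteSpace F] [CompleteSpace G]

theorem clm (h : IsPrimitiveOn f f' a b) (L : E →L[ℝ] F) :
    IsPrimitiveOn (fun t => L (f t)) (fun t => L (f' t)) a b := by
  refine ⟨L.integrable_comp h.integrableOn, fun t ht => ?_⟩
  have hab : a ∈ Icc a b := left_mem_Icc.2 (ht.1.trans ht.2)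
  rw [L.intervalIntegral_comp_comm (h.integrableOn.intervalIntegrable_of_mem hab ht),
    h.eq_add t ht, map_add]

theorem neg (h : IsPrimitiveOn f f' a b) :
    IsPrimitiveOn (fun t => -f t) (fun t => -f' t) a b :=
  h.clm (-ContinuousLinearMap.id ℝ E)

theorem sub (h : IsPrimitiveOn f f' a b) {k k' : ℝ → E} (hk : IsPrimitiveOn k k' a b) :
    IsPrimitiveOn (fun t => f t - k t) (fun t => f' t - k' t) a b := by
  simpa only [sub_eq_add_neg] using h.add hk.neg

end IsPrimitiveOn

theorem MeasureTheory.IntegrableOn.bilin_continuousOn {f' : ℝ → E} {g : ℝ → F} {a b : ℝ}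
    (B : E →L[ℝ] F →L[ℝ] G) (hf : IntegrableOn f' (Icc a b)) (hg : ContinuousOn g (Icc a b)) :
    IntegrableOn (fun t => B (f' t) (g t)) (Icc a b) := by
  obtain ⟨C, hC⟩ := isCompact_Icc.exists_bound_of_continuousOn hg
  refine Integrable.mono' (hf.norm.const_mul (‖B‖ * C)) ?_ ?_
  · have := B.isBoundedBilinearMap.continuous
    exact B.aestronglyMeasurable_comp₂ hf.aestronglyMeasurable
      (hg.aestronglyMeasurable measurableSet_Icc)
  · refine (ae_restrict_iff' measurableSet_Icc).2 (.of_forall fun t ht => ?_)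
    calc ‖B (f' t) (g t)‖ ≤ ‖B‖ * ‖f' t‖ * ‖g t‖ := B.le_opNorm₂ _ _
      _ ≤ ‖B‖ * ‖f' t‖ * C := by gcongr; exact hC t ht
      _ = _ := by ring

/-- The product rule for primitives. -/
theorem IsPrimitiveOn.bilin [CompleteSpace E] [CompleteSpace F] [CompleteSpace G]
    {f f' : ℝ → E} {g g' : ℝ → F} {a b : ℝ} (B : E →L[ℝ] F →L[ℝ] G)
    (hf : IsPrimitiveOn f f' a b) (hg : IsPrimitiveOn g g' a b) :
    IsPrimitiveOn (fun t => B (f t) (g t)) (fun t => B (f' t) (g t) + B (f t) (g' t)) a b := by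
  have i1 : IntegrableOn (fun t => B (f' t) (g t)) (Icc a b) :=
    hf.integrableOn.bilin_continuousOn B hg.continuousOn
  have i2 : IntegrableOn (fun t => B (f t) (g' t)) (Icc a b) :=
    hg.integrableOn.bilin_continuousOn B.flip hf.continuousOn
  refine ⟨i1.add i2, fun t ht => ?_⟩
  have hab : a ∈ Icc a b := left_mem_Icc.2 (ht.1.trans ht.2)
  have hsub : Ioc a t ⊆ Icc a b := fun x hx => ⟨hx.1.le, hx.2.trans ht.2⟩
  have jf := hf.integrableOn.mono_set hsub
  have jg := hg.integrableOn.mono_set hsub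
  rw [intervalIntegral.integral_add (i1.intervalIntegrable_of_mem hab ht)
    (i2.intervalIntegrable_of_mem hab ht), intervalIntegral.integral_of_le ht.1,
    intervalIntegral.integral_of_le ht.1]
  -- Splitting off the initial values reduces the product rule to `integral_bilin_primitive`.
  have k1 : ∫ s in Ioc a t, B (f' s) (g s)
      = B (∫ s in Ioc a t, f' s) (g a) + ∫ s in Ioc a t, B (f' s) (∫ τ in a..s, g' τ) := by
    have hh : IntegrableOn (fun s => B.flip (g a) (f' s)) (Ioc a t) :=
      (B.flip (g a)).integrable_comp jf
    have e : ∀ s ∈ Ioc a t, B (f' s) (∫ τ in a..s, g' τ)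
        = B (f' s) (g s) - B.flip (g a) (f' s) := by
      intro s hs
      rw [hg.eq_add s (hsub hs)]; simp
    rw [setIntegral_congr_fun measurableSet_Ioc e,
      integral_sub (i1.mono_set hsub) hh, (B.flip (g a)).integral_comp_comm jf]
    simp
  have k2 : ∫ s in Ioc a t, B (f s) (g' s)
      = B (f a) (∫ s in Ioc a t, g' s) + ∫ s in Ioc a t, B (∫ τ in a..s, f' τ) (g' s) := by
    have hh : IntegrableOn (fun s => B (f a) (g' s)) (Ioc a t) := (B (f a)).integrable_comp jg
    have e : ∀ s ∈ Ioc a t, B (∫ τ in a..s, f' τ) (g' s) = B (f s) (g' s) - B (f a) (g' s) := by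
      intro s hs
      rw [hf.eq_add s (hsub hs)]; simp
    rw [setIntegral_congr_fun measurableSet_Ioc e,
      integral_sub (i2.mono_set hsub) hh, (B (f a)).integral_comp_comm jg]
    simp
  rw [k1, k2, hf.eq_add t ht, hg.eq_add t ht, intervalIntegral.integral_of_le ht.1,
    intervalIntegral.integral_of_le ht.1]
  have := integral_bilin_primitive B jf jg
  simp only [map_add, add_apply]
  rw [← this]
  abel

end Calculus

/-! ### Linear differential equations with integrable coefficients. -/

section LinearODE

/-- Induction by the product rule for `α` times the previous term, rescaled by `1 / (n + 2)`. This
is the integration step of the Picard estimate. -/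
theorem IsPrimitiveOn.pow_div_factorial {α k : ℝ → ℝ} {a b : ℝ} (h : IsPrimitiveOn α k a b)
    (n : ℕ) : IsPrimitiveOn (fun t => α t ^ (n + 1) / (n + 1).factorial)
      (fun t => k t * (α t ^ n / n.factorial)) a b := by
  induction n with
  | zero => simpa using h
  | succ n ih =>
    have h1 := (h.bilin (ContinuousLinearMap.mul ℝ ℝ) ih).clm
      (((n + 2 : ℝ)⁻¹) • ContinuousLinearMap.id ℝ ℝ)
    refine (h1.congr fun t _ => ?_).congr_deriv fun t => ?_
    · simp only [ContinuousLinearMap.mul_apply', smul_apply,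
        ContinuousLinearMap.id_apply, smul_eq_mul, Nat.factorial_succ (n + 1)]
      push_cast
      have : ((n + 1).factorial : ℝ) ≠ 0 := by positivity
      field_simp
      ring
    · simp only [ContinuousLinearMap.mul_apply', smul_apply,
        ContinuousLinearMap.id_apply, smul_eq_mul, Nat.factorial_succ n]
      push_cast
      have : (n.factorial : ℝ) ≠ 0 := by positivity
      field_simp
      ring

variable {E : Type*} [NormedAddCommGroup E] [NormedSpace ℝ E]

theorem MeasureTheory.IntegrableOn.clm_apply_continuousOn {F : Type*} [NormedAddCommGroup F]
    [NormedSpace ℝ F] {A : ℝ → E →L[ℝ] F} {x : ℝ → E} {a b : ℝ}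
    (hA : IntegrableOn A (Icc a b)) (hx : ContinuousOn x (Icc a b)) :
    IntegrableOn (fun t => A t (x t)) (Icc a b) :=
  hA.bilin_continuousOn (ContinuousLinearMap.id ℝ (E →L[ℝ] F)) hx

/-- The Picard operator of the linear equation `x' = A x`, `x a = x₀`. -/
def picardMap {A : ℝ → E →L[ℝ] E} {a b : ℝ} (hab : a ≤ b) (hA : IntegrableOn A (Icc a b))
    (x₀ : E) (x : C(Icc a b, E)) : C(Icc a b, E) where
  toFun s := x₀ + ∫ τ in a..s, A τ (IccExtend hab x τ)
  continuous_toFun := by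
    have h1 : IntegrableOn (fun τ => A τ (IccExtend hab x τ)) (Icc a b) :=
      hA.clm_apply_continuousOn (x.continuous.Icc_extend' (h := hab)).continuousOn
    have h2 : ContinuousOn (fun s => ∫ τ in a..s, A τ (IccExtend hab x τ)) (Icc a b) :=
      (intervalIntegral.continuousOn_primitive h1).congr
        fun t ht => intervalIntegral.integral_of_le ht.1
    exact continuous_const.add (continuousOn_iff_continuous_domRestrict.1 h2)

/-- `A` need not be bounded, so `∫ ‖A‖` plays the role of Lipschitz constant times elapsed time;
each iteration integrates the previous bound against `‖A‖`. -/
theorem norm_picardMap_iterate_sub_le {A : ℝ → E →L[ℝ] E} {a b : ℝ} (hab : a ≤ b)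
    (hA : IntegrableOn A (Icc a b)) (x₀ : E) (x y : C(Icc a b, E)) (n : ℕ) (s : Icc a b) :
    ‖(picardMap hab hA x₀)^[n] x s - (picardMap hab hA x₀)^[n] y s‖
      ≤ (∫ τ in a..s, ‖A τ‖) ^ n / n.factorial * dist x y := by
  have hα : IsPrimitiveOn (fun s => ∫ τ in a..s, ‖A τ‖) (fun τ => ‖A τ‖) a b :=
    ⟨hA.norm, fun t _ => by simp⟩
  have ha : a ∈ Icc a b := ⟨le_rfl, hab⟩
  induction n generalizing s with
  | zero =>
    simp only [Function.iterate_zero, id, pow_zero, Nat.factorial_zero, Nat.cast_one, div_one,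
      one_mul, ← dist_eq_norm]
    exact ContinuousMap.dist_apply_le_dist s
  | succ n ih =>
    have hi (z : C(Icc a b, E)) : IntegrableOn (fun τ => A τ (IccExtend hab z τ)) (Icc a b) :=
      hA.clm_apply_continuousOn (z.continuous.Icc_extend' (h := hab)).continuousOn
    rw [Function.iterate_succ_apply', Function.iterate_succ_apply']
    set X := (picardMap hab hA x₀)^[n] x
    set Y := (picardMap hab hA x₀)^[n] y
    have e : picardMap hab hA x₀ X s - picardMap hab hA x₀ Y s
        = ∫ τ in a..s, A τ (IccExtend hab X τ - IccExtend hab Y τ) := by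
      simp only [picardMap, ContinuousMap.coe_mk, add_sub_add_left_eq_sub, map_sub]
      rw [intervalIntegral.integral_sub ((hi X).intervalIntegrable_of_mem ha s.2)
        ((hi Y).intervalIntegrable_of_mem ha s.2)]
    have hp := hα.pow_div_factorial n
    have e2 := hp.sub_eq ha s.2
    simp only [intervalIntegral.integral_same, ne_eq, Nat.add_eq_zero_iff, one_ne_zero, and_false,
      not_false_eq_true, zero_pow, zero_div, sub_zero] at e2
    rw [e, e2, ← intervalIntegral.integral_mul_const]
    refine intervalIntegral.norm_integral_le_of_norm_le s.2.1 (.of_forall fun τ hτ => ?_)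
      ((hp.integrableOn.intervalIntegrable_of_mem ha s.2).mul_const _)
    have hτ' : τ ∈ Icc a b := ⟨hτ.1.le, hτ.2.trans s.2.2⟩
    refine ((A τ).le_opNorm _).trans ?_
    rw [mul_assoc]
    gcongr
    have := ih ⟨τ, hτ'⟩
    rwa [IccExtend_of_mem _ _ hτ', IccExtend_of_mem _ _ hτ']

/-- The linear equation `x' = A x` with integrable `A` has a solution with any initial value. -/
theorem exists_isPrimitiveOn_linear [CompleteSpace E] {A : ℝ → E →L[ℝ] E} {a b : ℝ} (hab : a ≤ b)
    (hA : IntegrableOn A (Icc a b)) (x₀ : E) :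
    ∃ x : ℝ → E, x a = x₀ ∧ IsPrimitiveOn x (fun t => A t (x t)) a b := by
  set α := ∫ τ in a..b, ‖A τ‖ with hα
  have hα0 : 0 ≤ α := intervalIntegral.integral_nonneg hab fun _ _ => norm_nonneg _
  -- The Picard map need not contract, but its iterates eventually do; the fixed point of such an
  -- iterate is also fixed by the map.
  obtain ⟨n, hn⟩ := ((FloorSemiring.tendsto_pow_div_factorial_atTop α).eventually_lt_const
    (show (0 : ℝ) < 1 by norm_num)).exists
  have hα1 : 0 ≤ α ^ n / n.factorial := by positivity
  have hc : ContractingWith (NNReal.mk (α ^ n / n.factorial) hα1)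
      (picardMap hab hA x₀)^[n] := by
    refine ⟨by exact_mod_cast hn, LipschitzWith.of_dist_le_mul fun x y => ?_⟩
    change _ ≤ α ^ n / n.factorial * dist x y
    rw [ContinuousMap.dist_le (mul_nonneg hα1 dist_nonneg)]
    intro s
    rw [dist_eq_norm]
    refine (norm_picardMap_iterate_sub_le hab hA x₀ x y n s).trans ?_
    have h0 : 0 ≤ ∫ τ in a..s, ‖A τ‖ :=
      intervalIntegral.integral_nonneg s.2.1 fun _ _ => norm_nonneg _
    gcongr
    exact intervalIntegral.integral_mono_interval le_rfl s.2.1 s.2.2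
      (.of_forall fun _ => norm_nonneg _)
      (IntegrableOn.intervalIntegrable_of_mem hA.norm ⟨le_rfl, hab⟩ ⟨hab, le_rfl⟩)
  have hfix := hc.isFixedPt_fixedPoint_iterate
  set x := ContractingWith.fixedPoint _ hc
  have hx (t : Icc a b) : x t = x₀ + ∫ τ in a..t, A τ (IccExtend hab x τ) :=
    congrArg (fun z : C(Icc a b, E) => z t) hfix.eq.symm
  have hxa : IccExtend hab x a = x₀ := by
    rw [IccExtend_of_mem _ _ ⟨le_rfl, hab⟩, hx]; simp
  refine ⟨IccExtend hab x, hxa, ?_, fun t ht => ?_⟩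
  · exact hA.clm_apply_continuousOn (x.continuous.Icc_extend' (h := hab)).continuousOn
  · rw [hxa, IccExtend_of_mem _ _ ht, hx]

end LinearODE

/-! ### Operator-valued primitives and fundamental solutions. -/

section Operators

/-- Taking adjoints, as a continuous linear map over `ℝ`. -/
def adjointCLM (V W : Type*) [NormedAddCommGroup V] [InnerProductSpace ℝ V] [CompleteSpace V]
    [NormedAddCommGroup W] [InnerProductSpace ℝ W] [CompleteSpace W] :
    (V →L[ℝ] W) →L[ℝ] (W →L[ℝ] V) where
  toFun A := A†
  map_add' := map_add _
  map_smul' c A := by simp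
  cont := ContinuousLinearMap.adjoint.continuous

variable {V : Type*} [NormedAddCommGroup V] [InnerProductSpace ℝ V] [CompleteSpace V]

namespace IsPrimitiveOn

variable {a b : ℝ} {f f' g g' : ℝ → V →L[ℝ] V} {x x' y y' : ℝ → V}

theorem clm_comp (hf : IsPrimitiveOn f f' a b) (hg : IsPrimitiveOn g g' a b) :
    IsPrimitiveOn (fun t => f t ∘L g t) (fun t => f' t ∘L g t + f t ∘L g' t) a b :=
  hf.bilin (ContinuousLinearMap.compL ℝ V V V) hg

theorem clm_apply (hf : IsPrimitiveOn f f' a b) (hx : IsPrimitiveOn x x' a b) :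
    IsPrimitiveOn (fun t => f t (x t)) (fun t => f' t (x t) + f t (x' t)) a b :=
  hf.bilin (ContinuousLinearMap.id ℝ (V →L[ℝ] V)) hx

theorem clm_apply_const (hf : IsPrimitiveOn f f' a b) (v : V) :
    IsPrimitiveOn (fun t => f t v) (fun t => f' t v) a b :=
  hf.clm (ContinuousLinearMap.apply ℝ V v)

theorem inner (hx : IsPrimitiveOn x x' a b) (hy : IsPrimitiveOn y y' a b) :
    IsPrimitiveOn (fun t => ⟪x t, y t⟫_ℝ) (fun t => ⟪x' t, y t⟫_ℝ + ⟪x t, y' t⟫_ℝ) a b :=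
  hx.bilin (innerSL ℝ) hy

theorem adjoint (hf : IsPrimitiveOn f f' a b) :
    IsPrimitiveOn (fun t => (f t)†) (fun t => (f' t)†) a b :=
  hf.clm (adjointCLM V V)

theorem eq_of_ae_eq_zero {E : Type*} [NormedAddCommGroup E] [NormedSpace ℝ E] {f f' : ℝ → E}
    (h : IsPrimitiveOn f f' a b)
    (h0 : ∀ᵐ t ∂(volume.restrict (Icc a b)), f' t = 0) {s t : ℝ} (hs : s ∈ Icc a b)
    (ht : t ∈ Icc a b) : f s = f t := by
  have h1 : IsPrimitiveOn f (fun _ => 0) a b := h.congr_ae h0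
  have := h1.sub_eq ht hs
  simpa [sub_eq_zero] using this

theorem le_of_ae_nonneg {f f' : ℝ → ℝ} (h : IsPrimitiveOn f f' a b)
    (h0 : ∀ᵐ t ∂(volume.restrict (Icc a b)), 0 ≤ f' t) (hab : a ≤ b) : f a ≤ f b := by
  rw [h.eq_add b ⟨hab, le_rfl⟩]
  have := intervalIntegral.integral_nonneg_of_ae_restrict hab h0
  linarith

end IsPrimitiveOn

omit [CompleteSpace V] in
theorem MeasureTheory.IntegrableOn.clm_comp_continuousOn {f g : ℝ → V →L[ℝ] V} {a b : ℝ}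
    (hf : IntegrableOn f (Icc a b)) (hg : ContinuousOn g (Icc a b)) :
    IntegrableOn (fun t => f t ∘L g t) (Icc a b) :=
  hf.bilin_continuousOn (ContinuousLinearMap.compL ℝ V V V) hg

omit [CompleteSpace V] in
theorem ContinuousOn.clm_comp_integrableOn {f g : ℝ → V →L[ℝ] V} {a b : ℝ}
    (hf : ContinuousOn f (Icc a b)) (hg : IntegrableOn g (Icc a b)) :
    IntegrableOn (fun t => f t ∘L g t) (Icc a b) :=
  hg.bilin_continuousOn (ContinuousLinearMap.compL ℝ V V V).flip hf

theorem MeasureTheory.IntegrableOn.clm_adjoint {V W : Type*} [NormedAddCommGroup V]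
    [InnerProductSpace ℝ V] [CompleteSpace V] [NormedAddCommGroup W] [InnerProductSpace ℝ W]
    [CompleteSpace W] {f : ℝ → V →L[ℝ] W} {a b : ℝ}
    (hf : IntegrableOn f (Icc a b)) : IntegrableOn (fun t => (f t)†) (Icc a b) :=
  (adjointCLM V W).integrable_comp hf

/-- `X` solves `X' = A X` and its inverse `Y` solves `Y' = -Y A`, on `[a, b]`. -/
structure IsFundamentalPair (A X Y : ℝ → V →L[ℝ] V) (a b : ℝ) : Prop where
  forward : IsPrimitiveOn X (fun t => A t ∘L X t) a b
  backward : IsPrimitiveOn Y (fun t => -(Y t ∘L A t)) a b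
  inv_comp : ∀ t ∈ Icc a b, Y t ∘L X t = ContinuousLinearMap.id ℝ V
  comp_inv : ∀ t ∈ Icc a b, X t ∘L Y t = ContinuousLinearMap.id ℝ V

omit [CompleteSpace V] in
theorem ContinuousLinearMap.comp_eq_id_symm [FiniteDimensional ℝ V] {f g : V →L[ℝ] V}
    (h : f ∘L g = ContinuousLinearMap.id ℝ V) : g ∘L f = ContinuousLinearMap.id ℝ V := by
  have h1 : (f : V →ₗ[ℝ] V) * (g : V →ₗ[ℝ] V) = 1 := by
    ext v; exact congrArg (fun k : V →L[ℝ] V => k v) h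
  have h2 := mul_eq_one_comm.1 h1
  ext v
  exact congrArg (fun k : V →ₗ[ℝ] V => k v) h2

/-- `Y` is the adjoint of the solution of `Z' = -A* Z`, so `Y X` has zero derivative and stays the
identity; in finite dimension a left inverse is also a right inverse. -/
theorem exists_isFundamentalPair [FiniteDimensional ℝ V] {A : ℝ → V →L[ℝ] V} {a b : ℝ}
    (hab : a ≤ b) (hA : IntegrableOn A (Icc a b)) :
    ∃ X Y, IsFundamentalPair A X Y a b ∧ X a = ContinuousLinearMap.id ℝ V := by
  have key (M : ℝ → V →L[ℝ] V) (hM : IntegrableOn M (Icc a b) volume) : ∃ X : ℝ → V →L[ℝ] V,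
      X a = ContinuousLinearMap.id ℝ V ∧ IsPrimitiveOn X (fun t => M t ∘L X t) a b :=
    exists_isPrimitiveOn_linear hab
      (A := fun t => ContinuousLinearMap.compL ℝ V V V (M t))
      (ContinuousLinearMap.integrable_comp _ hM) _
  obtain ⟨X, hX0, hX⟩ := key A hA
  obtain ⟨Z, hZ0, hZ⟩ := key (fun t => -(A t)†) hA.clm_adjoint.neg
  have hY : IsPrimitiveOn (fun t => (Z t)†) (fun t => -((Z t)† ∘L A t)) a b :=
    hZ.adjoint.congr_deriv fun t => by
      rw [ContinuousLinearMap.adjoint_comp]; simp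
  have hYX : ∀ t ∈ Icc a b, (Z t)† ∘L X t = ContinuousLinearMap.id ℝ V := by
    intro t ht
    have := (hY.clm_comp hX).eq_of_ae_eq_zero (.of_forall fun s => by
      ext v; simp) ht ⟨le_rfl, hab⟩
    rw [this, hX0, hZ0]
    rw [ContinuousLinearMap.adjoint_id, ContinuousLinearMap.id_comp]
  exact ⟨X, fun t => (Z t)†, ⟨hX, hY, hYX, fun t ht =>
    ContinuousLinearMap.comp_eq_id_symm (hYX t ht)⟩, hX0⟩

namespace IsFundamentalPair

variable {A X Y : ℝ → V →L[ℝ] V} {a b : ℝ}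

omit [CompleteSpace V] in
theorem apply_inv (h : IsFundamentalPair A X Y a b) {t : ℝ} (ht : t ∈ Icc a b) (v : V) :
    X t (Y t v) = v :=
  congrArg (fun k : V →L[ℝ] V => k v) (h.comp_inv t ht)

theorem adjoint_inv_apply (h : IsFundamentalPair A X Y a b) {t : ℝ} (ht : t ∈ Icc a b) (v : V) :
    ((Y t)†) (((X t)†) v) = v := by
  have := congrArg (fun k : V →L[ℝ] V => (k†) v) (h.comp_inv t ht)
  simpa [ContinuousLinearMap.adjoint_comp, ContinuousLinearMap.adjoint_id] using this

/-- `Y x` has zero derivative. This supplies uniqueness for linear equations without a Gronwall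
estimate. -/
theorem solution_eq (h : IsFundamentalPair A X Y a b) {x : ℝ → V}
    (hx : IsPrimitiveOn x (fun t => A t (x t)) a b) {s t : ℝ} (hs : s ∈ Icc a b)
    (ht : t ∈ Icc a b) : x s = X s (Y t (x t)) := by
  have := (h.backward.clm_apply hx).eq_of_ae_eq_zero (.of_forall fun τ => by simp) ht hs
  rw [this, h.apply_inv hs]

theorem operator_solution_eq (h : IsFundamentalPair A X Y a b) {Z : ℝ → V →L[ℝ] V}
    (hZ : IsPrimitiveOn Z (fun t => A t ∘L Z t) a b) {s t : ℝ} (hs : s ∈ Icc a b)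
    (ht : t ∈ Icc a b) : Z s = X s ∘L Y t ∘L Z t := by
  ext v
  exact h.solution_eq (hZ.clm_apply_const v) hs ht

theorem adjoint_backward (h : IsFundamentalPair A X Y a b) :
    IsPrimitiveOn (fun t => (Y t)†) (fun t => -((A t)† ∘L (Y t)†)) a b :=
  h.backward.adjoint.congr_deriv fun t => by
    rw [← ContinuousLinearMap.adjoint_comp]; simp

theorem adjoint_forward (h : IsFundamentalPair A X Y a b) :
    IsPrimitiveOn (fun t => (X t)†) (fun t => (X t)† ∘L (A t)†) a b :=
  h.forward.adjoint.congr_deriv fun t => by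
    rw [← ContinuousLinearMap.adjoint_comp]

/-- A solution of `-q' = A* q + g` in terms of the fundamental pair. -/
theorem adjoint_solution (h : IsFundamentalPair A X Y a b) {q g : ℝ → V}
    (hq : IsPrimitiveOn q (fun t => -(((A t)†) (q t) + g t)) a b) :
    IsPrimitiveOn (fun t => ((X t)†) (q t)) (fun t => -(((X t)†) (g t))) a b :=
  (h.adjoint_forward.clm_apply hq).congr_deriv fun t => by simp

end IsFundamentalPair

omit [CompleteSpace V] in
-- The form at `x + c N x` is `2c ‖N x‖² + c² ⟨N N x, N x⟩`, which is negative for small `c < 0`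
-- unless `N x = 0`.
theorem ContinuousLinearMap.IsPositive.apply_eq_zero {N : V →L[ℝ] V} (hN : N.IsPositive) {x : V}
    (hx : ⟪N x, x⟫_ℝ = 0) : N x = 0 := by
  have h (c : ℝ) : 0 ≤ 2 * c * ‖N x‖ ^ 2 + c ^ 2 * ⟪N (N x), N x⟫_ℝ := by
    have h1 := hN.inner_nonneg_left (x + c • N x)
    have h2 : ⟪N (N x), x⟫_ℝ = ⟪N x, N x⟫_ℝ := hN.isSymmetric _ _
    simp only [map_add, map_smul, inner_add_left, inner_add_right, inner_smul_left,
      inner_smul_right, hx, h2, real_inner_self_eq_norm_sq] at h1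
    simp at h1
    nlinarith
  by_contra hne
  have hpos : 0 < ‖N x‖ ^ 2 := by positivity
  have hk : 0 ≤ ⟪N (N x), N x⟫_ℝ := hN.inner_nonneg_left _
  set k := ⟪N (N x), N x⟫_ℝ
  set m := ‖N x‖ ^ 2
  -- Near the minimiser `-m / k`; the `+ 1` covers `k = 0`.
  have := h (-(m / (k + 1)))
  have e : 2 * (-(m / (k + 1))) * m + (-(m / (k + 1))) ^ 2 * k
      = -(m ^ 2 * (k + 2)) / (k + 1) ^ 2 := by field_simp; ring
  rw [e] at this
  have : 0 < m ^ 2 * (k + 2) / (k + 1) ^ 2 := by positivity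
  rw [neg_div] at *
  linarith

end Operators

/-! ### Riccati equation: global existence, symmetry, positivity. -/

section Riccati

variable {V : Type*} [NormedAddCommGroup V] [InnerProductSpace ℝ V] [CompleteSpace V]
  [FiniteDimensional ℝ V] {F N K : ℝ → V →L[ℝ] V} {P₀ : V →L[ℝ] V} {a b : ℝ}

/-- The operator `x ↦ ι (M ∘ π x)`, as a continuous linear function of `M`. -/
def leftCompBetween {E : Type*} [NormedAddCommGroup E] [NormedSpace ℝ E]
    (ι : (V →L[ℝ] V) →L[ℝ] E) (π : E →L[ℝ] (V →L[ℝ] V)) : (V →L[ℝ] V) →L[ℝ] E →L[ℝ] E :=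
  (ContinuousLinearMap.compL ℝ E (V →L[ℝ] V) E ι) ∘L
    ((ContinuousLinearMap.compL ℝ E (V →L[ℝ] V) (V →L[ℝ] V)).flip π) ∘L
      ContinuousLinearMap.compL ℝ V V V

theorem MeasureTheory.IntegrableOn.fun_add_normed {E : Type*} [NormedAddCommGroup E]
    {f g : ℝ → E} {s : Set ℝ} (hf : IntegrableOn f s) (hg : IntegrableOn g s) :
    IntegrableOn (fun t => f t + g t) s :=
  hf.add hg

omit [FiniteDimensional ℝ V] in
/-- The Hamiltonian system of the Riccati equation has a solution. -/
theorem exists_hamiltonian (hab : a ≤ b) (hF : IntegrableOn F (Icc a b))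
    (hN : IntegrableOn N (Icc a b)) (hK : IntegrableOn K (Icc a b)) (P₀ : V →L[ℝ] V) :
    ∃ X Y : ℝ → V →L[ℝ] V, X a = P₀ ∧ Y a = ContinuousLinearMap.id ℝ V ∧
      IsPrimitiveOn X (fun t => F t ∘L X t + K t ∘L Y t) a b ∧
      IsPrimitiveOn Y (fun t => -((F t)† ∘L Y t) + N t ∘L X t) a b := by
  let p₁ := ContinuousLinearMap.fst ℝ (V →L[ℝ] V) (V →L[ℝ] V)
  let p₂ := ContinuousLinearMap.snd ℝ (V →L[ℝ] V) (V →L[ℝ] V)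
  let i₁ := ContinuousLinearMap.inl ℝ (V →L[ℝ] V) (V →L[ℝ] V)
  let i₂ := ContinuousLinearMap.inr ℝ (V →L[ℝ] V) (V →L[ℝ] V)
  have h (ι : (V →L[ℝ] V) →L[ℝ] (V →L[ℝ] V) × (V →L[ℝ] V))
      (π : (V →L[ℝ] V) × (V →L[ℝ] V) →L[ℝ] (V →L[ℝ] V)) {M : ℝ → V →L[ℝ] V}
      (hM : IntegrableOn M (Icc a b) volume) :
      IntegrableOn (fun t => leftCompBetween ι π (M t)) (Icc a b) volume :=
    ContinuousLinearMap.integrable_comp _ hM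
  have hA := ((h i₁ p₁ hF).fun_add_normed (h i₁ p₂ hK)).fun_add_normed
    ((h i₂ p₂ hF.clm_adjoint.neg).fun_add_normed (h i₂ p₁ hN))
  obtain ⟨x, hx0, hx⟩ := exists_isPrimitiveOn_linear hab hA (P₀, ContinuousLinearMap.id ℝ V)
  refine ⟨fun t => (x t).1, fun t => (x t).2, by simp [hx0], by simp [hx0],
    (hx.clm p₁).congr_deriv fun t => ?_, (hx.clm p₂).congr_deriv fun t => ?_⟩
  · simp [leftCompBetween, p₁, i₁, i₂, p₂]
  · simp [leftCompBetween, p₁, i₁, i₂, p₂]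

/-- Suppose `Y t y = 0`. The function `⟨X y, Y y⟩` is nondecreasing, is nonnegative at `a` because
`P₀ ≥ 0`, and vanishes at `t`. Its derivative is therefore zero almost everywhere on `[a, t]`, which
forces `N X y = 0`. Then `Y y` solves the homogeneous equation `q' = -F* q` and vanishes at `t`, so
its initial value `y` is zero. -/
theorem hamiltonian_isUnit (hF : IntegrableOn F (Icc a b))
    (hNpos : ∀ᵐ t ∂(volume.restrict (Icc a b)), (N t).IsPositive)
    (hKpos : ∀ᵐ t ∂(volume.restrict (Icc a b)), (K t).IsPositive) (hP₀ : P₀.IsPositive)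
    {X Y : ℝ → V →L[ℝ] V} (hXa : X a = P₀) (hYa : Y a = ContinuousLinearMap.id ℝ V)
    (hX : IsPrimitiveOn X (fun t => F t ∘L X t + K t ∘L Y t) a b)
    (hY : IsPrimitiveOn Y (fun t => -((F t)† ∘L Y t) + N t ∘L X t) a b)
    {t : ℝ} (ht : t ∈ Icc a b) : IsUnit (Y t) := by
  have hinj : Function.Injective (Y t) := by
    refine (injective_iff_map_eq_zero _).2 fun y hy => ?_
    have hle : volume.restrict (Icc a t) ≤ volume.restrict (Icc a b) :=
      Measure.restrict_mono (Icc_subset_Icc le_rfl ht.2) le_rfl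
    have hq := (hY.clm_apply_const y).mono le_rfl ht.2
    have hx := (hX.clm_apply_const y).mono le_rfl ht.2
    have hd : IsPrimitiveOn (fun s => ⟪X s y, Y s y⟫_ℝ)
        (fun s => ⟪K s (Y s y), Y s y⟫_ℝ + ⟪X s y, N s (X s y)⟫_ℝ) a t :=
      (hx.inner hq).congr_deriv fun s => by
        simp only [add_apply, ContinuousLinearMap.comp_apply, neg_apply, inner_add_left,
          inner_add_right, inner_neg_right, ContinuousLinearMap.adjoint_inner_right]
        ring
    have h0 : ∀ᵐ s ∂(volume.restrict (Icc a t)),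
        0 ≤ ⟪K s (Y s y), Y s y⟫_ℝ + ⟪X s y, N s (X s y)⟫_ℝ := by
      filter_upwards [ae_mono hle hNpos, ae_mono hle hKpos] with s h1 h2
      exact add_nonneg (h2.inner_nonneg_left _) (h1.inner_nonneg_right _)
    have h1 := hd.eq_add t ⟨ht.1, le_rfl⟩
    have h2 : 0 ≤ ⟪X a y, Y a y⟫_ℝ := by
      rw [hXa, hYa]; exact hP₀.inner_nonneg_left y
    have h3 : ∫ s in a..t, (⟪K s (Y s y), Y s y⟫_ℝ + ⟪X s y, N s (X s y)⟫_ℝ) = 0 := by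
      have := intervalIntegral.integral_nonneg_of_ae_restrict ht.1 h0
      rw [hy, inner_zero_right] at h1
      linarith
    rw [intervalIntegral.integral_of_le ht.1, ← integral_Icc_eq_integral_Ioc,
      integral_eq_zero_iff_of_nonneg_ae h0 hd.integrableOn] at h3
    have h4 : ∀ᵐ s ∂(volume.restrict (Icc a t)), N s (X s y) = 0 := by
      filter_upwards [ae_mono hle hNpos, ae_mono hle hKpos, h3] with s h1 h2 h3
      refine h1.apply_eq_zero ?_
      have e1 := h2.inner_nonneg_left (Y s y)
      have e2 := h1.inner_nonneg_right (X s y)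
      simp only [Pi.zero_apply] at h3
      rw [real_inner_comm]
      linarith
    obtain ⟨Z, W, hp, hZa⟩ := exists_isFundamentalPair ht.1
      (hF.mono_set (Icc_subset_Icc le_rfl ht.2))
    have hq' : IsPrimitiveOn (fun s => Y s y) (fun s => -(((F s)†) (Y s y) + 0)) a t :=
      hq.congr_ae (by filter_upwards [h4] with s hs; simp [hs])
    have h5 := (hp.adjoint_solution hq').eq_of_ae_eq_zero (.of_forall fun s => by simp)
      (s := a) (t := t) ⟨le_rfl, ht.1⟩ ⟨ht.1, le_rfl⟩
    simpa [hy, hYa, hZa, ContinuousLinearMap.adjoint_id] using h5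
  rw [ContinuousLinearMap.isUnit_iff_bijective]
  exact ⟨hinj, LinearMap.surjective_of_injective (f := (Y t : V →ₗ[ℝ] V)) hinj⟩

/-- The Riccati equation has a solution on the whole interval. -/
theorem exists_riccati (hab : a ≤ b) (hF : IntegrableOn F (Icc a b))
    (hN : IntegrableOn N (Icc a b)) (hK : IntegrableOn K (Icc a b))
    (hNpos : ∀ᵐ t ∂(volume.restrict (Icc a b)), (N t).IsPositive)
    (hKpos : ∀ᵐ t ∂(volume.restrict (Icc a b)), (K t).IsPositive) (hP₀ : P₀.IsPositive) :
    ∃ P : ℝ → V →L[ℝ] V, P a = P₀ ∧ IsPrimitiveOn P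
      (fun t => F t ∘L P t + P t ∘L (F t)† - P t ∘L N t ∘L P t + K t) a b := by
  obtain ⟨X, Y, hXa, hYa, hX, hY⟩ := exists_hamiltonian hab hF hN hK P₀
  have hu : ∀ t ∈ Icc a b, IsUnit (Y t) := fun t ht =>
    hamiltonian_isUnit hF hNpos hKpos hP₀ hXa hYa hX hY ht
  set P : ℝ → V →L[ℝ] V := fun t => X t ∘L Ring.inverse (Y t) with hP
  have hPY : ∀ t ∈ Icc a b, P t ∘L Y t = X t := fun t ht => by
    have : Ring.inverse (Y t) * Y t = 1 := Ring.inverse_mul_cancel _ (hu t ht)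
    rw [hP]
    change X t * Ring.inverse (Y t) * Y t = X t
    rw [mul_assoc, this, mul_one]
  -- Only continuity of `P = X Y⁻¹` comes from continuity of inversion. It makes `B = -F* + N P`
  -- integrable, and `Y' = B Y` identifies `Y` with a fundamental solution whose inverse `W` is a
  -- primitive; the product rule then applies to `P = X W`.
  have hPc : ContinuousOn P (Icc a b) := by
    refine hX.continuousOn.clm_comp fun t ht => ?_
    obtain ⟨u, hu⟩ := hu t ht
    have h1 := NormedRing.inverse_continuousAt u
    rw [hu] at h1
    exact h1.comp_continuousWithinAt (hY.continuousOn t ht)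
  set B : ℝ → V →L[ℝ] V := fun t => -(F t)† + N t ∘L P t with hB
  have hBi : IntegrableOn B (Icc a b) := hF.clm_adjoint.neg.add (hN.clm_comp_continuousOn hPc)
  obtain ⟨U, W, hp, hUa⟩ := exists_isFundamentalPair hab hBi
  have hYB : IsPrimitiveOn Y (fun t => B t ∘L Y t) a b := by
    refine hY.congr_ae ((ae_restrict_iff' measurableSet_Icc).2 (.of_forall fun t ht => ?_))
    ext v
    simp [hB, ← hPY t ht]
  have hWa : W a = ContinuousLinearMap.id ℝ V := by
    have := hp.inv_comp a ⟨le_rfl, hab⟩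
    rwa [hUa, ContinuousLinearMap.comp_id] at this
  have hYU : ∀ t ∈ Icc a b, Y t = U t := fun t ht => by
    rw [hp.operator_solution_eq hYB ht ⟨le_rfl, hab⟩, hWa, hYa]
    simp
  have hPW : ∀ t ∈ Icc a b, P t = X t ∘L W t := fun t ht => by
    rw [← hPY t ht, hYU t ht, ContinuousLinearMap.comp_assoc, hp.comp_inv t ht,
      ContinuousLinearMap.comp_id]
  refine ⟨P, ?_, ?_⟩
  · rw [hPW a ⟨le_rfl, hab⟩, hWa, hXa, ContinuousLinearMap.comp_id]
  · refine ((hX.clm_comp hp.backward).congr hPW).congr_ae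
      ((ae_restrict_iff' measurableSet_Icc).2 (.of_forall fun t ht => ?_))
    have e1 := hPW t ht
    have e2 : Y t ∘L W t = ContinuousLinearMap.id ℝ V := by
      rw [hYU t ht, hp.comp_inv t ht]
    have e3 (v : V) : X t (W t v) = P t v := by rw [e1]; rfl
    have e4 (v : V) : Y t (W t v) = v := congrArg (fun k : V →L[ℝ] V => k v) e2
    ext v
    simp [hB, e3, e4]
    abel

variable {P : ℝ → V →L[ℝ] V}

/-- The difference `Δ = P - P*` solves the linear equation `Δ' = (F - P* N) Δ + Δ (F* - N P)` with
`Δ a = 0`. Multiplying by fundamental solutions on both sides gives a constant. -/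
theorem riccati_adjoint_eq (hab : a ≤ b) (hF : IntegrableOn F (Icc a b))
    (hN : IntegrableOn N (Icc a b))
    (hNpos : ∀ᵐ t ∂(volume.restrict (Icc a b)), (N t).IsPositive)
    (hKpos : ∀ᵐ t ∂(volume.restrict (Icc a b)), (K t).IsPositive)
    (hPa : (P a).IsPositive) (hP : IsPrimitiveOn P
      (fun t => F t ∘L P t + P t ∘L (F t)† - P t ∘L N t ∘L P t + K t) a b)
    {t : ℝ} (ht : t ∈ Icc a b) : (P t)† = P t := by
  have hi1 : IntegrableOn (fun s => F s - (P s)† ∘L N s) (Icc a b) :=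
    hF.sub (hP.adjoint.continuousOn.clm_comp_integrableOn hN)
  have hi2 : IntegrableOn (fun s => -((F s)† - N s ∘L P s)) (Icc a b) :=
    (hF.clm_adjoint.sub (hN.clm_comp_continuousOn hP.continuousOn)).neg
  obtain ⟨X₁, Y₁, h₁, -⟩ := exists_isFundamentalPair hab hi1
  obtain ⟨X₂, Y₂, h₂, -⟩ := exists_isFundamentalPair hab hi2
  have hd := (h₁.backward.clm_comp (hP.sub hP.adjoint)).clm_comp h₂.forward
  have h0 := hd.eq_of_ae_eq_zero (s := t) (t := a) (by
    filter_upwards [hNpos, hKpos] with s hs1 hs2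
    have e1 : (N s)† = N s := hs1.isSelfAdjoint.adjoint_eq
    have e2 : (K s)† = K s := hs2.isSelfAdjoint.adjoint_eq
    ext v
    simp [ContinuousLinearMap.adjoint_comp, e1, e2]
    abel) ht ⟨le_rfl, hab⟩
  have ha : (P a)† = P a := hPa.isSelfAdjoint.adjoint_eq
  rw [ha, sub_self] at h0
  ext v
  have h3 := congrArg (fun k : V →L[ℝ] V => X₁ t (k (Y₂ t v))) h0
  simp only [ContinuousLinearMap.comp_apply, sub_apply, h₂.apply_inv ht, h₁.apply_inv ht,
    zero_apply, ContinuousLinearMap.comp_zero, ContinuousLinearMap.zero_comp, map_zero] at h3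
  exact (sub_eq_zero.1 h3).symm

/-- Along the solution of `y' = -(F - P N)* y` with `y b = v`, the derivative of `⟨P y, y⟩` is `⟨N P
y, P y⟩ + ⟨K y, y⟩ ≥ 0`, and the value at `a` is nonnegative. -/
theorem riccati_inner_nonneg (hab : a ≤ b) (hF : IntegrableOn F (Icc a b))
    (hN : IntegrableOn N (Icc a b))
    (hNpos : ∀ᵐ t ∂(volume.restrict (Icc a b)), (N t).IsPositive)
    (hKpos : ∀ᵐ t ∂(volume.restrict (Icc a b)), (K t).IsPositive)
    (hPa : (P a).IsPositive) (hP : IsPrimitiveOn P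
      (fun t => F t ∘L P t + P t ∘L (F t)† - P t ∘L N t ∘L P t + K t) a b)
    (v : V) : 0 ≤ ⟪P b v, v⟫_ℝ := by
  have hsymm : ∀ t ∈ Icc a b, (P t)† = P t := fun t ht =>
    riccati_adjoint_eq hab hF hN hNpos hKpos hPa hP ht
  have hi1 : IntegrableOn (fun s => F s - P s ∘L N s) (Icc a b) :=
    hF.sub (hP.continuousOn.clm_comp_integrableOn hN)
  obtain ⟨X, Y, hp, -⟩ := exists_isFundamentalPair hab hi1
  have hb : b ∈ Icc a b := ⟨hab, le_rfl⟩
  have hy := hp.adjoint_backward.clm_apply_const (((X b)†) v)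
  have hd := (hP.clm_apply hy).inner hy
  have hle := hd.le_of_ae_nonneg (by
    filter_upwards [hNpos, hKpos, ae_restrict_mem measurableSet_Icc] with s hs1 hs2 hs
    have e1 : (N s)† = N s := hs1.isSelfAdjoint.adjoint_eq
    set y := ((Y s)†) (((X b)†) v) with hy
    have k1 : ⟪P s (((F s)†) y), y⟫_ℝ = ⟪F s (P s y), y⟫_ℝ := by
      rw [← ContinuousLinearMap.adjoint_inner_right, hsymm s hs,
        ContinuousLinearMap.adjoint_inner_left, real_inner_comm]
    have k2 : 0 ≤ ⟪P s (N s (P s y)), y⟫_ℝ := by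
      rw [← ContinuousLinearMap.adjoint_inner_right, hsymm s hs]
      exact hs1.inner_nonneg_left _
    have k3 := hs2.inner_nonneg_left y
    simp only [neg_apply, ContinuousLinearMap.comp_apply, ← hy, map_sub, add_apply, sub_apply,
      ContinuousLinearMap.adjoint_comp, hsymm s hs, e1, inner_add_left, inner_sub_left,
      inner_sub_right, neg_sub]
    have k4 : ⟪P s y, ((F s)†) y⟫_ℝ = ⟪F s (P s y), y⟫_ℝ :=
      ContinuousLinearMap.adjoint_inner_right _ _ _
    have k5 : ⟪P s y, N s (P s y)⟫_ℝ = ⟪P s (N s (P s y)), y⟫_ℝ := by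
      rw [← ContinuousLinearMap.adjoint_inner_right (P s), hsymm s hs, real_inner_comm]
    rw [k4, k5, k1]
    linarith) hab
  simp only [hp.adjoint_inv_apply hb] at hle
  exact (hPa.inner_nonneg_left _).trans hle

end Riccati

/-! ### Square roots and inverses of operators: measurability and bounds. -/

section SquareRoot

variable {n : ℕ}

theorem toEuclideanCLM_symm_nonneg_iff (A : Euc n →L[ℝ] Euc n) :
    0 ≤ (Matrix.toEuclideanCLM (n := Fin n) (𝕜 := ℝ)).symm A ↔ A.IsPositive := by
  rw [Matrix.nonneg_iff_posSemidef, ← Matrix.isPositive_toEuclideanLin_iff]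
  have : Matrix.toEuclideanLin ((Matrix.toEuclideanCLM (n := Fin n) (𝕜 := ℝ)).symm A)
      = (A : Euc n →ₗ[ℝ] Euc n) := by
    rw [← Matrix.coe_toEuclideanCLM_eq_toEuclideanLin, StarAlgEquiv.apply_symm_apply]
  rw [this]
  rfl

theorem psdSqrt_adjoint (A : Euc n →L[ℝ] Euc n) : (psdSqrt A)† = psdSqrt A := by
  have h : IsSelfAdjoint (CFC.sqrt ((Matrix.toEuclideanCLM (n := Fin n) (𝕜 := ℝ)).symm A)) :=
    IsSelfAdjoint.of_nonneg (CFC.sqrt_nonneg _)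
  exact (h.map (Matrix.toEuclideanCLM (n := Fin n) (𝕜 := ℝ))).adjoint_eq

theorem psdSqrt_comp_self {A : Euc n →L[ℝ] Euc n} (hA : A.IsPositive) :
    psdSqrt A ∘L psdSqrt A = A := by
  have h := CFC.sqrt_mul_sqrt_self _ ((toEuclideanCLM_symm_nonneg_iff A).2 hA)
  have h2 := congrArg (Matrix.toEuclideanCLM (n := Fin n) (𝕜 := ℝ)) h
  rw [map_mul, StarAlgEquiv.apply_symm_apply] at h2
  exact h2

theorem psdSqrt_of_not_isPositive {A : Euc n →L[ℝ] Euc n} (hA : ¬ A.IsPositive) :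
    psdSqrt A = 0 := by
  rw [psdSqrt, CFC.sqrt_of_not_nonneg (fun h => hA ((toEuclideanCLM_symm_nonneg_iff A).1 h)),
    map_zero]

open scoped Matrix.Norms.L2Operator in
theorem continuousOn_psdSqrt :
    ContinuousOn (psdSqrt (n := n)) {A : Euc n →L[ℝ] Euc n | A.IsPositive} := by
  have h1 : Continuous (Matrix.toEuclideanCLM (n := Fin n) (𝕜 := ℝ)) :=
    LinearMap.continuous_of_finiteDimensional
      (Matrix.toEuclideanCLM (n := Fin n) (𝕜 := ℝ)).toAlgEquiv.toLinearMap
  have h2 : Continuous (Matrix.toEuclideanCLM (n := Fin n) (𝕜 := ℝ)).symm :=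
    LinearMap.continuous_of_finiteDimensional
      (Matrix.toEuclideanCLM (n := Fin n) (𝕜 := ℝ)).symm.toAlgEquiv.toLinearMap
  exact h1.comp_continuousOn ((CFC.continuousOn_sqrt (A := Matrix (Fin n) (Fin n) ℝ)).comp
    h2.continuousOn fun A hA => (toEuclideanCLM_symm_nonneg_iff A).2 hA)

theorem isClosed_setOf_isPositive :
    IsClosed {A : Euc n →L[ℝ] Euc n | A.IsPositive} := by
  have : {A : Euc n →L[ℝ] Euc n | A.IsPositive}
      = {A | A† = A} ∩ ⋂ x : Euc n, {A | 0 ≤ ⟪A x, x⟫_ℝ} := by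
    ext A
    simp only [mem_ofPred_eq, mem_inter_iff, mem_iInter]
    rw [ContinuousLinearMap.isPositive_def', ContinuousLinearMap.isSelfAdjoint_iff']
    rfl
  rw [this]
  refine (isClosed_eq (adjointCLM _ _).continuous continuous_id).inter (isClosed_iInter fun x => ?_)
  exact isClosed_le continuous_const (by fun_prop)

/-- `psdSqrt` is continuous on the closed cone of positive operators and has the default value `0`
off it. Measurability of `t ↦ R(t)^{1/2}` follows. -/
theorem measurable_psdSqrt : Measurable (psdSqrt (n := n)) := by
  classical
  have h := (continuousOn_psdSqrt (n := n)).measurable_piecewise (g := fun _ => 0)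
    continuousOn_const isClosed_setOf_isPositive.measurableSet
  convert h using 1
  ext1 A
  by_cases hA : A.IsPositive
  · simp [piecewise, hA]
  · simp [piecewise, hA, psdSqrt_of_not_isPositive hA]

/-- Inversion is continuous on the open set of units, and `Ring.inverse` is `0` elsewhere. -/
theorem measurable_ringInverse :
    Measurable (Ring.inverse : (Euc n →L[ℝ] Euc n) → Euc n →L[ℝ] Euc n) := by
  classical
  have hc : ContinuousOn (Ring.inverse : (Euc n →L[ℝ] Euc n) → Euc n →L[ℝ] Euc n)
      {A | IsUnit A} := by
    rintro A ⟨u, rfl⟩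
    exact (NormedRing.inverse_continuousAt u).continuousWithinAt
  have h := hc.measurable_piecewise (g := fun _ => 0) continuousOn_const Units.isOpen.measurableSet
  convert h using 1
  ext1 A
  by_cases hA : IsUnit A
  · simp [piecewise, hA]
  · simp [piecewise, hA]

theorem isUnit_of_forall_le_inner {A : Euc n →L[ℝ] Euc n} {r : ℝ} (hr : 0 < r)
    (h : ∀ x, r * ‖x‖ ^ 2 ≤ ⟪A x, x⟫_ℝ) : IsUnit A := by
  have hinj : Function.Injective A := by
    refine (injective_iff_map_eq_zero _).2 fun x hx => ?_
    have := h x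
    rw [hx, inner_zero_left] at this
    by_contra hne
    have : 0 < r * ‖x‖ ^ 2 := by positivity
    linarith
  rw [ContinuousLinearMap.isUnit_iff_bijective]
  exact ⟨hinj, LinearMap.surjective_of_injective (f := (A : Euc n →ₗ[ℝ] Euc n)) hinj⟩

theorem ringInverse_apply_self {A : Euc n →L[ℝ] Euc n} (h : IsUnit A) (x : Euc n) :
    Ring.inverse A (A x) = x :=
  congrArg (fun k : Euc n →L[ℝ] Euc n => k x) (Ring.inverse_mul_cancel A h)

theorem apply_ringInverse {A : Euc n →L[ℝ] Euc n} (h : IsUnit A) (x : Euc n) :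
    A (Ring.inverse A x) = x :=
  congrArg (fun k : Euc n →L[ℝ] Euc n => k x) (Ring.mul_inverse_cancel A h)

/-- An operator that is bounded below by a positive multiple of the identity. -/
structure IsUniformlyPositive (r : ℝ) (A : Euc n →L[ℝ] Euc n) : Prop where
  isPositive : A.IsPositive
  le_inner : ∀ x, r * ‖x‖ ^ 2 ≤ ⟪A x, x⟫_ℝ

theorem IsUniformlyPositive.of_sub {A : Euc n →L[ℝ] Euc n} {r : ℝ} (hr : 0 < r)
    (h : (A - r • ContinuousLinearMap.id ℝ (Euc n)).IsPositive) : IsUniformlyPositive r A where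
  isPositive := by
    have h2 : (r • ContinuousLinearMap.id ℝ (Euc n)).IsPositive :=
      ContinuousLinearMap.isPositive_id.smul_of_nonneg hr.le
    simpa using h.add h2
  le_inner x := by
    have := h.inner_nonneg_left x
    simp only [sub_apply, smul_apply, ContinuousLinearMap.id_apply,
      inner_sub_left, inner_smul_left, real_inner_self_eq_norm_sq] at this
    simpa using this

namespace IsUniformlyPositive

variable {A : Euc n →L[ℝ] Euc n} {r : ℝ}

theorem inner_psdSqrt (h : IsUniformlyPositive r A) (x y : Euc n) :
    ⟪psdSqrt A x, psdSqrt A y⟫_ℝ = ⟪A x, y⟫_ℝ := by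
  rw [← ContinuousLinearMap.adjoint_inner_left, psdSqrt_adjoint,
    ← ContinuousLinearMap.comp_apply, psdSqrt_comp_self h.isPositive]

theorem isUnit (h : IsUniformlyPositive r A) (hr : 0 < r) : IsUnit A :=
  isUnit_of_forall_le_inner hr h.le_inner

theorem isUnit_psdSqrt (h : IsUniformlyPositive r A) (hr : 0 < r) : IsUnit (psdSqrt A) := by
  have h1 : psdSqrt A * psdSqrt A = A := psdSqrt_comp_self h.isPositive
  have h2 : IsUnit (psdSqrt A * psdSqrt A) := by rw [h1]; exact h.isUnit hr
  exact ((Commute.refl _).isUnit_mul_iff.1 h2).1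

/-- For `y = A^{-1/2} x`, coercivity reads `r ‖y‖² ≤ ⟨A y, y⟩ = ‖x‖²`. -/
theorem norm_ringInverse_psdSqrt_apply_le (h : IsUniformlyPositive r A) (hr : 0 < r) (x : Euc n) :
    ‖Ring.inverse (psdSqrt A) x‖ ≤ (√r)⁻¹ * ‖x‖ := by
  set y := Ring.inverse (psdSqrt A) x with hy
  have h1 := h.le_inner y
  rw [← h.inner_psdSqrt, hy, apply_ringInverse (h.isUnit_psdSqrt hr), ← hy,
    real_inner_self_eq_norm_sq] at h1
  rw [inv_mul_eq_div, le_div_iff₀ (Real.sqrt_pos.2 hr)]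
  refine abs_le_of_sq_le_sq' ?_ (norm_nonneg _) |>.2
  rw [mul_pow, Real.sq_sqrt hr.le]
  linarith

theorem norm_ringInverse_le (h : IsUniformlyPositive r A) (hr : 0 < r) : ‖Ring.inverse A‖ ≤ r⁻¹ := by
  refine ContinuousLinearMap.opNorm_le_bound _ (by positivity) fun x => ?_
  set y := Ring.inverse A x with hy
  have h1 := (h.le_inner y).trans (real_inner_le_norm _ _)
  rw [hy, apply_ringInverse (h.isUnit hr), ← hy] at h1
  rw [inv_mul_eq_div, le_div_iff₀ hr]
  rcases (norm_nonneg y).eq_or_lt with h0 | h0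
  · rw [← h0]; simp
  · nlinarith

theorem isPositive_ringInverse (h : IsUniformlyPositive r A) (hr : 0 < r) :
    (Ring.inverse A).IsPositive := by
  have hu := h.isUnit hr
  rw [ContinuousLinearMap.isPositive_def', ContinuousLinearMap.isSelfAdjoint_iff']
  have hs : ∀ x y, ⟪A x, y⟫_ℝ = ⟪x, A y⟫_ℝ := h.isPositive.isSymmetric
  refine ⟨?_, fun x => ?_⟩
  · symm
    rw [ContinuousLinearMap.eq_adjoint_iff]
    intro x y
    have := hs (Ring.inverse A x) (Ring.inverse A y)
    rw [apply_ringInverse hu, apply_ringInverse hu] at this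
    exact this.symm
  · have := h.isPositive.inner_nonneg_right (Ring.inverse A x)
    rw [apply_ringInverse hu] at this
    exact this

end IsUniformlyPositive

end SquareRoot

/-! ### Kernel sections and their costates. -/

section KernelSection

variable {V : Type*} [NormedAddCommGroup V] [InnerProductSpace ℝ V] [CompleteSpace V]
  [FiniteDimensional ℝ V] {F N K P X Y W : ℝ → V →L[ℝ] V} {a b t : ℝ} {p : V} {l : ℝ → V}

/-- The jump function `s ↦ 1_{t < s} X(s) Y(t) p - P(s) l(s)` from which the control of the kernel
section `l` at `t` is built. -/
def costateJump (P X Y : ℝ → V →L[ℝ] V) (t : ℝ) (p : V) (l : ℝ → V) (s : ℝ) : V :=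
  (if t < s then X s (Y t p) else 0) - P s (l s)

omit [CompleteSpace V] [FiniteDimensional ℝ V] in
theorem costateJump_of_le {s : ℝ} (h : s ≤ t) : costateJump P X Y t p l s = -P s (l s) := by
  simp [costateJump, not_lt.2 h]

omit [CompleteSpace V] [FiniteDimensional ℝ V] in
theorem costateJump_of_lt {s : ℝ} (h : t < s) :
    costateJump P X Y t p l s = X s (Y t p) - P s (l s) := by
  simp [costateJump, h]

theorem ae_lt_of_mem_Icc (t b : ℝ) : ∀ᵐ s ∂(volume.restrict (Icc t b)), t < s := by
  filter_upwards [ae_restrict_mem measurableSet_Icc, ae_restrict_of_ae (Measure.ae_ne volume t)]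
    with s hs hne using lt_of_le_of_ne hs.1 hne.symm

omit [FiniteDimensional ℝ V] in
-- The function is differentiated separately on `[a, t]`, where `W (max s t)` is frozen, and on `[t,
-- b]`, where `W'` contributes `-N X(s) Y(t) p`. The closed-loop term `N P l` is absorbed into the
-- costate, which leaves the open-loop equation driven by `N ξ`.
theorem kernelSection_isPrimitiveOn
    (hp : IsFundamentalPair (fun s => F s - P s ∘L N s) X Y a b)
    (hPs : ∀ s ∈ Icc a b, (P s)† = P s)
    (hNs : ∀ᵐ s ∂(volume.restrict (Icc a b)), (N s)† = N s)
    (hW : IsPrimitiveOn W (fun s => -((X s)† ∘L N s ∘L X s)) a b) (ht : t ∈ Icc a b)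
    (hl : ∀ s ∈ Icc a b, l s = ((Y s)†) (W (max s t) (Y t p))) :
    IsPrimitiveOn l (fun s => -(((F s)†) (l s) + N s (costateJump P X Y t p l s))) a b := by
  have hle₁ : volume.restrict (Icc a t) ≤ volume.restrict (Icc a b) :=
    Measure.restrict_mono (Icc_subset_Icc le_rfl ht.2) le_rfl
  have hle₂ : volume.restrict (Icc t b) ≤ volume.restrict (Icc a b) :=
    Measure.restrict_mono (Icc_subset_Icc ht.1 le_rfl) le_rfl
  refine IsPrimitiveOn.trans ht.1 ht.2 ?_ ?_
  · have h1 := (hp.adjoint_backward.mono le_rfl ht.2).clm_apply_const (W t (Y t p))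
    refine (h1.congr (k := l) fun s hs => ?_).congr_ae ?_
    · rw [hl s ⟨hs.1, hs.2.trans ht.2⟩, max_eq_right hs.2]
    · filter_upwards [ae_mono hle₁ hNs, ae_restrict_mem measurableSet_Icc] with s hN hs
      have hs' : s ∈ Icc a b := ⟨hs.1, hs.2.trans ht.2⟩
      rw [costateJump_of_le hs.2, hl s hs', max_eq_right hs.2]
      simp [ContinuousLinearMap.adjoint_comp, hN, hPs s hs']
      abel
  · have h1 := (hp.adjoint_backward.mono ht.1 le_rfl).clm_apply
      ((hW.mono ht.1 le_rfl).clm_apply_const (Y t p))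
    refine (h1.congr (k := l) fun s hs => ?_).congr_ae ?_
    · rw [hl s ⟨ht.1.trans hs.1, hs.2⟩, max_eq_left hs.1]
    · filter_upwards [ae_mono hle₂ hNs, ae_restrict_mem measurableSet_Icc, ae_lt_of_mem_Icc t b]
        with s hN hs hlt
      have hs' : s ∈ Icc a b := ⟨ht.1.trans hs.1, hs.2⟩
      rw [costateJump_of_lt hlt, hl s hs', max_eq_left hs.1]
      simp [ContinuousLinearMap.adjoint_comp, hN, hPs s hs', hp.adjoint_inv_apply hs']
      abel

omit [FiniteDimensional ℝ V] in
/-- The duality between a kernel section and the solutions of `-q' = F* q + h`. -/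
theorem kernelSection_pairing
    (hp : IsFundamentalPair (fun s => F s - P s ∘L N s) X Y a b)
    (hP : IsPrimitiveOn P
      (fun t => F t ∘L P t + P t ∘L (F t)† - P t ∘L N t ∘L P t + K t) a b)
    (hl : IsPrimitiveOn l
      (fun s => -(((F s)†) (l s) + N s (costateJump P X Y t p l s))) a b)
    (hK : IntegrableOn K (Icc a b)) (ht : t ∈ Icc a b) {q h : ℝ → V}
    (hq : IsPrimitiveOn q (fun s => -(((F s)†) (q s) + h s)) a b) :
    IntegrableOn (fun s => ⟪K s (l s), q s⟫_ℝ) (Icc a b) ∧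
    IntegrableOn (fun s => ⟪costateJump P X Y t p l s, h s⟫_ℝ) (Icc a b) ∧
    ⟪P a (l a), q a⟫_ℝ + ⟪X b (Y t p) - P b (l b), q b⟫_ℝ
      + (∫ s in Icc a b, ⟪K s (l s), q s⟫_ℝ)
      + ∫ s in Icc a b, ⟪costateJump P X Y t p l s, h s⟫_ℝ = ⟪p, q t⟫_ℝ := by
  have hab : a ≤ b := ht.1.trans ht.2
  set ξ := costateJump P X Y t p l with hξ
  have hPl := hP.clm_apply hl
  -- On either side of `t` the Riccati equation gives `ξ' = F ξ - K l`, so the derivative of `⟨ξ,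
  -- q⟩` is `-(⟨K l, q⟩ + ⟨ξ, h⟩)`. Adding both sides leaves the boundary terms and the jump `X t (Y
  -- t p) = p` at `t`.
  have h₁ : IsPrimitiveOn (fun s => ⟪-P s (l s), q s⟫_ℝ)
      (fun s => -(⟪K s (l s), q s⟫_ℝ + ⟪ξ s, h s⟫_ℝ)) a t := by
    refine ((hPl.neg.inner hq).mono le_rfl ht.2).congr_ae ?_
    filter_upwards [ae_restrict_mem measurableSet_Icc] with s hs
    rw [hξ, costateJump_of_le hs.2]
    simp only [add_apply, sub_apply, ContinuousLinearMap.comp_apply, map_neg, map_add,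
      inner_neg_left, inner_neg_right, inner_add_left, inner_sub_left, inner_add_right,
      ContinuousLinearMap.adjoint_inner_right]
    ring
  -- The right-hand branch is written out because `ξ` takes its left value at `t`; this keeps the
  -- case `t = b` valid.
  have h₂ : IsPrimitiveOn (fun s => ⟪X s (Y t p) - P s (l s), q s⟫_ℝ)
      (fun s => -(⟪K s (l s), q s⟫_ℝ + ⟪ξ s, h s⟫_ℝ)) t b := by
    refine ((((hp.forward.clm_apply_const (Y t p)).sub hPl).inner hq).mono ht.1 le_rfl).congr_ae ?_
    filter_upwards [ae_lt_of_mem_Icc t b] with s hs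
    rw [hξ, costateJump_of_lt hs]
    simp only [add_apply, sub_apply, ContinuousLinearMap.comp_apply, map_neg, map_add, map_sub,
      inner_neg_left, inner_neg_right, inner_add_left, inner_sub_left, inner_add_right,
      ContinuousLinearMap.adjoint_inner_right]
    ring
  have i0 : IntegrableOn (fun s => ⟪K s (l s), q s⟫_ℝ + ⟪ξ s, h s⟫_ℝ) (Icc a b) := by
    rw [← Icc_union_Icc_eq_Icc ht.1 ht.2]
    have := (h₁.integrableOn.union h₂.integrableOn).neg
    simpa only [Pi.neg_def, neg_neg] using this
  have i1 : IntegrableOn (fun s => ⟪K s (l s), q s⟫_ℝ) (Icc a b) :=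
    (hK.clm_apply_continuousOn hl.continuousOn).bilin_continuousOn (innerSL ℝ) hq.continuousOn
  have i2 : IntegrableOn (fun s => ⟪ξ s, h s⟫_ℝ) (Icc a b) := by
    have := i0.sub i1
    simpa only [Pi.sub_def, add_sub_cancel_left] using this
  refine ⟨i1, i2, ?_⟩
  have e1 := h₁.sub_eq (s := a) (t := t) ⟨le_rfl, ht.1⟩ ⟨ht.1, le_rfl⟩
  have e2 := h₂.sub_eq (s := t) (t := b) ⟨le_rfl, ht.2⟩ ⟨ht.2, le_rfl⟩
  have e3 := intervalIntegral.integral_add_adjacent_intervals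
    (h₁.integrableOn.intervalIntegrable_of_mem (s := a) (t := t) ⟨le_rfl, ht.1⟩ ⟨ht.1, le_rfl⟩)
    (h₂.integrableOn.intervalIntegrable_of_mem (s := t) (t := b) ⟨le_rfl, ht.2⟩ ⟨ht.2, le_rfl⟩)
  rw [← e1, ← e2, intervalIntegral.integral_neg, intervalIntegral.integral_of_le hab,
    ← integral_Icc_eq_integral_Ioc, integral_add i1 i2, hp.apply_inv ht] at e3
  simp only [inner_neg_left, inner_sub_left] at e3 ⊢
  linarith

/-- The quadratic form of the operator is `‖x‖² + ⟨Q S x, S x⟩ ≥ ‖x‖²`, so it is injective. -/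
theorem isUnit_id_add_conj {S Q : V →L[ℝ] V} (hS : S† = S) (hQ : ∀ v, 0 ≤ ⟪Q v, v⟫_ℝ) :
    IsUnit (ContinuousLinearMap.id ℝ V + S ∘L Q ∘L S) := by
  have hinj : Function.Injective (ContinuousLinearMap.id ℝ V + S ∘L Q ∘L S) := by
    refine (injective_iff_map_eq_zero _).2 fun x hx => ?_
    have h1 := congrArg (fun y => ⟪y, x⟫_ℝ) hx
    have h2 : ⟪S (Q (S x)), x⟫_ℝ = ⟪Q (S x), S x⟫_ℝ := by
      rw [← ContinuousLinearMap.adjoint_inner_right, hS]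
    simp only [add_apply, ContinuousLinearMap.id_apply, ContinuousLinearMap.comp_apply,
      inner_add_left, real_inner_self_eq_norm_sq, inner_zero_left, h2] at h1
    have h3 := hQ (S x)
    have : ‖x‖ ^ 2 = 0 := le_antisymm (by linarith) (by positivity)
    simpa using this
  rw [ContinuousLinearMap.isUnit_iff_bijective]
  exact ⟨hinj, LinearMap.surjective_of_injective
    (f := (ContinuousLinearMap.id ℝ V + S ∘L Q ∘L S : V →L[ℝ] V).toLinearMap) hinj⟩

end KernelSection

/-! ### Hölder inequalities for operator-valued functions. -/

section MemLpTools

variable {E F G : Type*} [NormedAddCommGroup E] [NormedSpace ℝ E]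
  [NormedAddCommGroup F] [NormedSpace ℝ F] [NormedAddCommGroup G] [NormedSpace ℝ G]

theorem MeasureTheory.MemLp.clm_bilin (B : E →L[ℝ] F →L[ℝ] G) {α : Type*} [MeasurableSpace α]
    {μ : Measure α} {p q r : ℝ≥0∞} [ENNReal.HolderTriple p q r] {f : α → E} {g : α → F}
    (hf : MemLp f p μ) (hg : MemLp g q μ) : MemLp (fun x => B (f x) (g x)) r μ :=
  MemLp.of_bilin (fun x y => B x y) ‖B‖₊ hf hg
    (B.aestronglyMeasurable_comp₂ hf.aestronglyMeasurable hg.aestronglyMeasurable)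
    (.of_forall fun _ => B.le_opNorm₂ _ _)

theorem MeasureTheory.MemLp.clm_apply {α : Type*} [MeasurableSpace α]
    {μ : Measure α} {p q r : ℝ≥0∞} [ENNReal.HolderTriple p q r] {f : α → E →L[ℝ] F} {g : α → E}
    (hf : MemLp f p μ) (hg : MemLp g q μ) : MemLp (fun x => f x (g x)) r μ :=
  hf.clm_bilin (ContinuousLinearMap.id ℝ (E →L[ℝ] F)) hg

theorem MeasureTheory.MemLp.clm_adjoint {V W : Type*} [NormedAddCommGroup V]
    [InnerProductSpace ℝ V] [CompleteSpace V] [NormedAddCommGroup W] [InnerProductSpace ℝ W]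
    [CompleteSpace W] {α : Type*} [MeasurableSpace α] {μ : Measure α} {p : ℝ≥0∞}
    {f : α → V →L[ℝ] W} (hf : MemLp f p μ) : MemLp (fun t => (f t)†) p μ :=
  (adjointCLM V W).comp_memLp' hf

omit [NormedSpace ℝ E] in
theorem ContinuousOn.memLp_top_Icc {f : ℝ → E} {a b : ℝ} (hf : ContinuousOn f (Icc a b)) :
    MemLp f ∞ (volume.restrict (Icc a b)) := by
  obtain ⟨C, hC⟩ := isCompact_Icc.exists_bound_of_continuousOn hf
  exact memLp_top_of_bound (hf.aestronglyMeasurable measurableSet_Icc) C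
    ((ae_restrict_iff' measurableSet_Icc).2 (.of_forall hC))

end MemLpTools

/-! ### Consequences of the standing assumptions. -/

namespace LinearSystem

variable {n m d : ℕ} {D : LinearSystem n m d}

theorem left_mem (D : LinearSystem n m d) : D.t₀ ∈ Icc D.t₀ D.T := ⟨le_rfl, D.t₀_lt_T.le⟩

theorem right_mem (D : LinearSystem n m d) : D.T ∈ Icc D.t₀ D.T := ⟨D.t₀_lt_T.le, le_rfl⟩

namespace Admissible

theorem F_int (hD : D.Admissible) : IntegrableOn D.F (Icc D.t₀ D.T) :=
  memLp_one_iff_integrable.1 hD.F_mem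

theorem GQG_int (hD : D.Admissible) : IntegrableOn D.GQG (Icc D.t₀ D.T) :=
  memLp_one_iff_integrable.1 hD.GQG_mem

theorem GQG_pos (hD : D.Admissible) : ∀ᵐ t ∂D.vol, (D.GQG t).IsPositive := by
  filter_upwards [hD.Q_pos] with t ht using ht.conj_adjoint _

theorem exists_uniformlyPositive (hD : D.Admissible) :
    ∃ r : ℝ, 0 < r ∧ ∀ᵐ t ∂D.vol, IsUniformlyPositive r (D.R t) := by
  obtain ⟨r, hr, h⟩ := hD.R_coercive
  exact ⟨r, hr, h.mono fun t ht => .of_sub hr ht⟩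

theorem isUnit_R (hD : D.Admissible) : ∀ᵐ t ∂D.vol, IsUnit (D.R t) := by
  obtain ⟨r, hr, h⟩ := hD.exists_uniformlyPositive
  exact h.mono fun t ht => ht.isUnit hr

theorem aestronglyMeasurable_R_inverse (hD : D.Admissible) :
    AEStronglyMeasurable (fun t => Ring.inverse (D.R t)) D.vol :=
  (measurable_ringInverse.comp_aemeasurable
    hD.R_mem.aestronglyMeasurable.aemeasurable).aestronglyMeasurable

/-- Coercivity gives `‖R⁻¹‖ ≤ 1 / r` almost everywhere. This is what makes `H* R⁻¹ H` integrable and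
the control `R⁻¹ H ξ` square integrable. -/
theorem inverse_R_comp_H_mem (hD : D.Admissible) :
    MemLp (fun t => Ring.inverse (D.R t) ∘L D.H t) 2 D.vol := by
  obtain ⟨r, hr, h⟩ := hD.exists_uniformlyPositive
  refine hD.H_mem.of_le_mul (c := r⁻¹) ?_ ?_
  · exact (ContinuousLinearMap.compL ℝ (Euc n) (Euc m) (Euc m)).aestronglyMeasurable_comp₂
      hD.aestronglyMeasurable_R_inverse hD.H_mem.aestronglyMeasurable
  · filter_upwards [h] with t ht
    exact (ContinuousLinearMap.opNorm_comp_le _ _).trans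
      (mul_le_mul_of_nonneg_right (ht.norm_ringInverse_le hr) (norm_nonneg _))

theorem HRH_int (hD : D.Admissible) : IntegrableOn D.HRH (Icc D.t₀ D.T) :=
  memLp_one_iff_integrable.1 (hD.H_mem.clm_adjoint.clm_bilin (p := 2) (q := 2)
    (ContinuousLinearMap.compL ℝ (Euc n) (Euc m) (Euc n)) hD.inverse_R_comp_H_mem)

theorem HRH_pos (hD : D.Admissible) : ∀ᵐ t ∂D.vol, (D.HRH t).IsPositive := by
  obtain ⟨r, hr, h⟩ := hD.exists_uniformlyPositive
  filter_upwards [h] with t ht using (ht.isPositive_ringInverse hr).adjoint_conj _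

theorem HRH_adjoint (hD : D.Admissible) : ∀ᵐ t ∂D.vol, (D.HRH t)† = D.HRH t := by
  filter_upwards [hD.HRH_pos] with t ht using ht.isSelfAdjoint.adjoint_eq

end Admissible

/-! ### Riccati and evolution equations -/

theorem IsRiccatiSolution.isPrimitiveOn (hD : D.Admissible) {P : ℝ → Euc n →L[ℝ] Euc n}
    (hP : D.IsRiccatiSolution P) : P D.t₀ = D.P₀ ∧ IsPrimitiveOn P
      (fun t => D.F t ∘L P t + P t ∘L (D.F t)† - P t ∘L D.HRH t ∘L P t + D.GQG t) D.t₀ D.T := by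
  refine ⟨by rw [hP.2 _ D.left_mem]; simp, IsPrimitiveOn.of_eq_add ?_ D.left_mem hP.2⟩
  exact (((hD.F_int.clm_comp_continuousOn hP.1).add
    (hP.1.clm_comp_integrableOn hD.F_int.clm_adjoint)).sub
    (hP.1.clm_comp_integrableOn (hD.HRH_int.clm_comp_continuousOn hP.1))).add hD.GQG_int

theorem exists_isRiccatiSolution (hD : D.Admissible) : ∃ P, D.IsRiccatiSolution P := by
  obtain ⟨P, hP0, hP⟩ := exists_riccati D.t₀_lt_T.le hD.F_int hD.HRH_int hD.GQG_int hD.HRH_pos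
    hD.GQG_pos hD.P₀_pos
  refine ⟨P, hP.continuousOn, fun t ht => ?_⟩
  rw [hP.eq_add t ht, hP0]

theorem IsRiccatiSolution.adjoint_eq (hD : D.Admissible) {P : ℝ → Euc n →L[ℝ] Euc n}
    (hP : D.IsRiccatiSolution P) {t : ℝ} (ht : t ∈ Icc D.t₀ D.T) : (P t)† = P t := by
  obtain ⟨h0, h1⟩ := hP.isPrimitiveOn hD
  exact riccati_adjoint_eq D.t₀_lt_T.le hD.F_int hD.HRH_int hD.HRH_pos hD.GQG_pos
    (h0 ▸ hD.P₀_pos) h1 ht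

theorem IsRiccatiSolution.inner_nonneg (hD : D.Admissible) {P : ℝ → Euc n →L[ℝ] Euc n}
    (hP : D.IsRiccatiSolution P) (v : Euc n) : 0 ≤ ⟪P D.T v, v⟫_ℝ := by
  obtain ⟨h0, h1⟩ := hP.isPrimitiveOn hD
  exact riccati_inner_nonneg D.t₀_lt_T.le hD.F_int hD.HRH_int hD.HRH_pos hD.GQG_pos
    (h0 ▸ hD.P₀_pos) h1 v

theorem isUnit_middle (hD : D.Admissible) {P : ℝ → Euc n →L[ℝ] Euc n}
    (hP : D.IsRiccatiSolution P) : IsUnit (D.middle P) :=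
  isUnit_id_add_conj (psdSqrt_adjoint _) (hP.inner_nonneg hD)

theorem exists_closedLoop_pair (hD : D.Admissible) {P : ℝ → Euc n →L[ℝ] Euc n}
    (hP : D.IsRiccatiSolution P) :
    ∃ X Y, IsFundamentalPair (fun s => D.F s - P s ∘L D.HRH s) X Y D.t₀ D.T := by
  obtain ⟨X, Y, h, -⟩ := exists_isFundamentalPair D.t₀_lt_T.le
    (A := fun s => D.F s - P s ∘L D.HRH s)
    (hD.F_int.sub (hP.1.clm_comp_integrableOn hD.HRH_int))
  exact ⟨X, Y, h⟩

theorem exists_isEvolution (hD : D.Admissible) {P : ℝ → Euc n →L[ℝ] Euc n}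
    (hP : D.IsRiccatiSolution P) : ∃ Φ, D.IsEvolution P Φ := by
  obtain ⟨X, Y, h⟩ := exists_closedLoop_pair hD hP
  refine ⟨fun s t => X s ∘L Y t, fun t ht => ?_⟩
  have h1 : IsPrimitiveOn (fun s => X s ∘L Y t)
      (fun s => (D.F s - P s ∘L D.HRH s) ∘L (X s ∘L Y t)) D.t₀ D.T :=
    h.forward.clm ((ContinuousLinearMap.compL ℝ (Euc n) (Euc n) (Euc n)).flip (Y t))
  refine ⟨h1.continuousOn, fun s hs => ?_⟩
  rw [← h1.sub_eq ht hs, h.comp_inv t ht]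
  abel

theorem IsEvolution.eq_comp (hD : D.Admissible) {P : ℝ → Euc n →L[ℝ] Euc n}
    (hP : D.IsRiccatiSolution P) {Φ : ℝ → ℝ → Euc n →L[ℝ] Euc n} (hΦ : D.IsEvolution P Φ)
    {X Y : ℝ → Euc n →L[ℝ] Euc n}
    (h : IsFundamentalPair (fun s => D.F s - P s ∘L D.HRH s) X Y D.t₀ D.T) {s t : ℝ}
    (hs : s ∈ Icc D.t₀ D.T) (ht : t ∈ Icc D.t₀ D.T) : Φ s t = X s ∘L Y t := by
  obtain ⟨hc, he⟩ := hΦ t ht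
  have hi : IntegrableOn (fun s => D.F s - P s ∘L D.HRH s) (Icc D.t₀ D.T) :=
    hD.F_int.sub (hP.1.clm_comp_integrableOn hD.HRH_int)
  have h1 : IsPrimitiveOn (fun s => Φ s t) (fun s => (D.F s - P s ∘L D.HRH s) ∘L Φ s t)
      D.t₀ D.T := .of_eq_add (hi.clm_comp_continuousOn hc) ht he
  have h2 : Φ t t = ContinuousLinearMap.id ℝ (Euc n) := by rw [he t ht]; simp
  rw [h.operator_solution_eq h1 hs ht, h2, ContinuousLinearMap.comp_id]

/-- The middle factor of the kernel in `Λ(s, t) = Y(s)* W(max s t) Y(t)`. -/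
def kernelCore (D : LinearSystem n m d) (P X : ℝ → Euc n →L[ℝ] Euc n) (s : ℝ) :
    Euc n →L[ℝ] Euc n :=
  (X D.T)† ∘L psdSqrt D.ST ∘L Ring.inverse (D.middle P) ∘L psdSqrt D.ST ∘L X D.T
    + ∫ τ in s..D.T, (X τ)† ∘L D.HRH τ ∘L X τ

theorem integrableOn_conj_HRH (hD : D.Admissible) {X : ℝ → Euc n →L[ℝ] Euc n}
    (hX : ContinuousOn X (Icc D.t₀ D.T)) :
    IntegrableOn (fun τ => (X τ)† ∘L D.HRH τ ∘L X τ) (Icc D.t₀ D.T) :=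
  ((adjointCLM _ _).continuous.comp_continuousOn hX).clm_comp_integrableOn
    (hD.HRH_int.clm_comp_continuousOn hX)

theorem kernelCore_isPrimitiveOn (hD : D.Admissible) (P : ℝ → Euc n →L[ℝ] Euc n)
    {X : ℝ → Euc n →L[ℝ] Euc n} (hX : ContinuousOn X (Icc D.t₀ D.T)) :
    IsPrimitiveOn (D.kernelCore P X) (fun s => -((X s)† ∘L D.HRH s ∘L X s)) D.t₀ D.T := by
  refine .of_eq_add (x := (X D.T)† ∘L psdSqrt D.ST ∘L Ring.inverse (D.middle P) ∘L psdSqrt D.ST ∘L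
    X D.T) (integrableOn_conj_HRH hD hX).neg D.right_mem fun t _ => ?_
  rw [intervalIntegral.integral_neg, ← intervalIntegral.integral_symm, kernelCore]

/-- Since `Φ(τ, s) = X(τ) Y(s)`, the factors `Y(s)*` and `Y(t)` leave the integral, and `s`, `t`
interact only through `max s t`. -/
theorem infoKernel_eq (hD : D.Admissible) {P : ℝ → Euc n →L[ℝ] Euc n}
    (hP : D.IsRiccatiSolution P) {Φ : ℝ → ℝ → Euc n →L[ℝ] Euc n} (hΦ : D.IsEvolution P Φ)
    {X Y : ℝ → Euc n →L[ℝ] Euc n}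
    (h : IsFundamentalPair (fun s => D.F s - P s ∘L D.HRH s) X Y D.t₀ D.T) {s t : ℝ}
    (hs : s ∈ Icc D.t₀ D.T) (ht : t ∈ Icc D.t₀ D.T) :
    D.infoKernel P Φ s t = (Y s)† ∘L D.kernelCore P X (max s t) ∘L Y t := by
  have hst : max s t ∈ Icc D.t₀ D.T := ⟨hs.1.trans (le_max_left _ _), max_le hs.2 ht.2⟩
  have e {τ σ : ℝ} (hτ : τ ∈ Icc D.t₀ D.T) (hσ : σ ∈ Icc D.t₀ D.T) : Φ τ σ = X τ ∘L Y σ :=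
    hΦ.eq_comp hD hP h hτ hσ
  let L : (Euc n →L[ℝ] Euc n) →L[ℝ] (Euc n →L[ℝ] Euc n) :=
    (ContinuousLinearMap.compL ℝ (Euc n) (Euc n) (Euc n) ((Y s)†)) ∘L
      (ContinuousLinearMap.compL ℝ (Euc n) (Euc n) (Euc n)).flip (Y t)
  have hL (M : Euc n →L[ℝ] Euc n) : L M = (Y s)† ∘L M ∘L Y t := rfl
  have hi : ∫ τ in (max s t)..D.T, (Φ τ s)† ∘L D.HRH τ ∘L Φ τ t
      = L (∫ τ in (max s t)..D.T, (X τ)† ∘L D.HRH τ ∘L X τ) := by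
    rw [← L.intervalIntegral_comp_comm ((integrableOn_conj_HRH hD
      h.forward.continuousOn).intervalIntegrable_of_mem hst D.right_mem)]
    refine intervalIntegral.integral_congr fun τ hτ => ?_
    have hτ' : τ ∈ Icc D.t₀ D.T := uIcc_subset_Icc hst D.right_mem hτ
    simp only [hL, e hτ' hs, e hτ' ht, ContinuousLinearMap.adjoint_comp,
      ContinuousLinearMap.comp_assoc]
  rw [infoKernel, hi, e D.right_mem hs, e D.right_mem ht, ← hL, kernelCore, map_add, hL, hL,
    ContinuousLinearMap.adjoint_comp]
  simp only [ContinuousLinearMap.comp_assoc]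

/-! ### Generated functions -/

theorem Admissible.H_adjoint_control_int (hD : D.Admissible) {v : ℝ → Euc m}
    (hv : MemLp v 2 D.vol) : IntegrableOn (fun t => ((D.H t)†) (v t)) (Icc D.t₀ D.T) :=
  memLp_one_iff_integrable.1 (hD.H_mem.clm_adjoint.clm_apply (p := 2) (q := 2) hv)

theorem Generates.isPrimitiveOn (hD : D.Admissible) {z : Euc n} {v : ℝ → Euc m}
    {l : D.Time → Euc n} (h : D.Generates z v l) :
    IsPrimitiveOn (IccExtend D.t₀_lt_T.le l)
      (fun τ => -(((D.F τ)†) (IccExtend D.t₀_lt_T.le l τ) + ((D.H τ)†) (v τ))) D.t₀ D.T := by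
  have hi : IntegrableOn (fun τ => ((D.F τ)†) (IccExtend D.t₀_lt_T.le l τ) + ((D.H τ)†) (v τ))
      (Icc D.t₀ D.T) :=
    (hD.F_int.clm_adjoint.clm_apply_continuousOn
      (h.continuous.Icc_extend' (h := D.t₀_lt_T.le)).continuousOn).add
      (hD.H_adjoint_control_int h.control_mem)
  refine .of_eq_add hi.neg D.right_mem (x := psdSqrt D.ST z) fun t ht => ?_
  rw [intervalIntegral.integral_neg, ← intervalIntegral.integral_symm,
    IccExtend_of_mem _ _ ht, h.equation]

theorem Generates.apply_right {z : Euc n} {v : ℝ → Euc m}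
    {l : D.Time → Euc n} (h : D.Generates z v l) :
    IccExtend D.t₀_lt_T.le l D.T = psdSqrt D.ST z := by
  rw [IccExtend_of_mem _ _ D.right_mem, h.equation]
  simp

theorem Generates.of_isPrimitiveOn {z : Euc n} {v : ℝ → Euc m} {f : ℝ → Euc n}
    (hv : MemLp v 2 D.vol) (hc : Integrable (fun t => ⟪D.R t (v t), v t⟫_ℝ) D.vol)
    (hf : IsPrimitiveOn f (fun τ => -(((D.F τ)†) (f τ) + ((D.H τ)†) (v τ))) D.t₀ D.T)
    (hT : f D.T = psdSqrt D.ST z) : D.Generates z v (fun t : D.Time => f t) := by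
  refine ⟨hv, hc, continuousOn_iff_continuous_domRestrict.1 hf.continuousOn, fun t => ?_⟩
  have h1 := hf.sub_eq D.right_mem t.2
  rw [intervalIntegral.integral_neg, ← intervalIntegral.integral_symm, hT] at h1
  rw [← sub_eq_iff_eq_add', h1]
  refine intervalIntegral.integral_congr fun τ hτ => ?_
  have hτ' : τ ∈ Icc D.t₀ D.T := uIcc_subset_Icc t.2 D.right_mem hτ
  rw [IccExtend_of_mem _ _ hτ']

end LinearSystem

/-! ### Transport of a Hilbert structure to an equivalent norm. -/

section HilbertTransfer

/-- A Hilbert space structure on a type in bijection with a Hilbert space `V`, for the inner product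
of `V` perturbed by a bounded positive symmetric bilinear form. -/
theorem exists_hilbert_structure_of_equiv {X V : Type*} [NormedAddCommGroup V]
    [InnerProductSpace ℝ V] [CompleteSpace V] (e : X ≃ V) (b : V → V → ℝ) (C : ℝ)
    (b_add : ∀ x y z, b (x + y) z = b x z + b y z) (b_smul : ∀ (c : ℝ) x y, b (c • x) y = c * b x y)
    (b_symm : ∀ x y, b x y = b y x) (b_nonneg : ∀ x, 0 ≤ b x x)
    (b_le : ∀ x, b x x ≤ C * ‖x‖ ^ 2) :
    ∃ (_ : NormedAddCommGroup X) (_ : InnerProductSpace ℝ X) (_ : CompleteSpace X)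
      (L : X →L[ℝ] V), ⇑L = e ∧ ∀ x y : X, inner ℝ x y = ⟪e x, e y⟫_ℝ + b (e x) (e y) := by
  let i1 : AddCommGroup X := e.addCommGroup
  let i2 : Module ℝ X := e.module ℝ
  let e' : X ≃ₗ[ℝ] V := e.linearEquiv ℝ
  have hadd (x y : X) : e (x + y) = e x + e y := e'.map_add x y
  have hsmul (c : ℝ) (x : X) : e (c • x) = c • e x := e'.map_smul c x
  let core : InnerProductSpace.Core ℝ X :=
    { inner := fun x y => ⟪e x, e y⟫_ℝ + b (e x) (e y)
      conj_inner_symm := fun x y => by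
        simp [real_inner_comm, b_symm (e x)]
      re_inner_nonneg := fun x => by
        simpa using add_nonneg (real_inner_self_nonneg (x := e x)) (b_nonneg (e x))
      add_left := fun x y z => by
        simp only [hadd, inner_add_left, b_add]; ring
      smul_left := fun x y c => by
        simp only [hsmul, inner_smul_left, b_smul, mul_add, conj_trivial]
      definite := fun x hx => by
        have h1 := real_inner_self_nonneg (x := e x)
        have h2 := b_nonneg (e x)
        have h3 : ⟪e x, e x⟫_ℝ = 0 := le_antisymm (by linarith) h1
        have h4 : e' x = 0 := inner_self_eq_zero.1 h3
        exact e'.map_eq_zero_iff.1 h4 }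
  let j1 : NormedAddCommGroup X := core.toNormedAddCommGroup
  let j2 : InnerProductSpace ℝ X := .ofCore core.toCore
  have hin (x y : X) : inner ℝ x y = ⟪e x, e y⟫_ℝ + b (e x) (e y) := rfl
  have hn (x : X) : ‖x‖ ^ 2 = ‖e x‖ ^ 2 + b (e x) (e x) := by
    rw [← real_inner_self_eq_norm_sq, hin, real_inner_self_eq_norm_sq]
  have hle (x : X) : ‖e' x‖ ≤ 1 * ‖x‖ := by
    rw [one_mul]
    refine abs_le_of_sq_le_sq' ?_ (norm_nonneg _) |>.2
    rw [hn]
    exact le_add_of_nonneg_right (b_nonneg _)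
  -- With `hle` this makes `e'` a linear homeomorphism, so completeness transfers. The absolute
  -- value is there because `C` has no assumed sign.
  have hge (v : V) : ‖e'.symm v‖ ≤ √(1 + |C|) * ‖v‖ := by
    refine abs_le_of_sq_le_sq' ?_ (by positivity) |>.2
    have h1 := hn (e'.symm v)
    have h2 : e (e'.symm v) = v := e'.apply_symm_apply v
    rw [h2] at h1
    rw [h1, mul_pow, Real.sq_sqrt (by positivity)]
    nlinarith [b_le v, le_abs_self C, sq_nonneg ‖v‖]
  let L : X ≃L[ℝ] V := e'.toContinuousLinearEquivOfBounds 1 (√(1 + |C|)) hle hge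
  have hc : CompleteSpace X := (completeSpace_congr (e := L.toEquiv) L.isUniformEmbedding).2 inferInstance
  exact ⟨j1, j2, hc, L, rfl, hin⟩

end HilbertTransfer

/-! ### Bounds for integrals. -/

section IntegralBounds

variable {E F : Type*} [NormedAddCommGroup E] [NormedSpace ℝ E]
  [NormedAddCommGroup F] [NormedSpace ℝ F]

theorem integral_norm_clm_apply_le {α : Type*} [MeasurableSpace α] {μ : Measure α}
    {A : α → E →L[ℝ] F} {w : α → E} (hA : MemLp A 2 μ) (hw : MemLp w 2 μ) :
    ∫ x, ‖A x (w x)‖ ∂μ ≤ (eLpNorm A 2 μ).toReal * (eLpNorm w 2 μ).toReal := by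
  have h1 : MemLp (fun x => A x (w x)) 1 μ := hA.clm_apply (p := 2) (q := 2) hw
  rw [integral_norm_eq_lintegral_enorm h1.aestronglyMeasurable, ← eLpNorm_one_eq_lintegral_enorm,
    ← ENNReal.toReal_mul]
  refine ENNReal.toReal_mono (ENNReal.mul_ne_top hA.2.ne hw.2.ne) ?_
  have := eLpNorm_le_eLpNorm_mul_eLpNorm_of_nnnorm (p := 2) (q := 2) (r := 1)
    hA.aestronglyMeasurable hw.aestronglyMeasurable (fun T x => T x) 1
    (.of_forall fun x => by simpa using (A x).le_opNNNorm (w x))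
  simpa using this

theorem norm_intervalIntegral_le_integral_norm {f : ℝ → E} {a b s t : ℝ}
    (hf : IntegrableOn f (Icc a b)) (hs : s ∈ Icc a b) (ht : t ∈ Icc a b) :
    ‖∫ τ in s..t, f τ‖ ≤ ∫ τ in Icc a b, ‖f τ‖ := by
  refine intervalIntegral.norm_integral_le_integral_norm_uIoc.trans ?_
  refine setIntegral_mono_set hf.norm (.of_forall fun _ => norm_nonneg _) ?_
  exact (uIoc_subset_uIcc.trans (uIcc_subset_Icc hs ht)).eventuallyLE

end IntegralBounds

namespace LinearSystem

variable {n m d : ℕ} {D : LinearSystem n m d}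

/-! ### The Hilbert space of controls -/

/-- The Hilbert space of pairs `(z, w)` with `w = R^{1/2} v ∈ L²`. -/
abbrev ControlSpace (D : LinearSystem n m d) : Type := WithLp 2 (Euc n × Lp (Euc m) 2 D.vol)

/-- The control `v = R^{-1/2} w` of a pair `(z, w)`. -/
def control (u : D.ControlSpace) (t : ℝ) : Euc m :=
  Ring.inverse (psdSqrt (D.R t)) (u.snd t)

theorem psdSqrt_control (hD : D.Admissible) (u : D.ControlSpace) :
    ∀ᵐ t ∂D.vol, psdSqrt (D.R t) (control u t) = u.snd t := by
  obtain ⟨r, hr, h⟩ := hD.exists_uniformlyPositive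
  filter_upwards [h] with t ht using apply_ringInverse (ht.isUnit_psdSqrt hr) _

theorem inner_R_control (hD : D.Admissible) (u₁ u₂ : D.ControlSpace) :
    ∀ᵐ t ∂D.vol, ⟪D.R t (control u₁ t), control u₂ t⟫_ℝ = ⟪u₁.snd t, u₂.snd t⟫_ℝ := by
  obtain ⟨r, hr, h⟩ := hD.exists_uniformlyPositive
  filter_upwards [h, psdSqrt_control hD u₁, psdSqrt_control hD u₂] with t ht h1 h2
  rw [← ht.inner_psdSqrt, h1, h2]

theorem Admissible.aestronglyMeasurable_psdSqrt_R (hD : D.Admissible) :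
    AEStronglyMeasurable (fun t => psdSqrt (D.R t)) D.vol :=
  (measurable_psdSqrt.comp_aemeasurable
    hD.R_mem.aestronglyMeasurable.aemeasurable).aestronglyMeasurable

theorem control_mem (hD : D.Admissible) (u : D.ControlSpace) : MemLp (control u) 2 D.vol := by
  obtain ⟨r, hr, h⟩ := hD.exists_uniformlyPositive
  refine (Lp.memLp u.snd).of_le_mul (c := (√r)⁻¹) ?_ ?_
  · exact (ContinuousLinearMap.id ℝ (Euc m →L[ℝ] Euc m)).aestronglyMeasurable_comp₂
      (measurable_ringInverse.comp_aemeasurable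
        hD.aestronglyMeasurable_psdSqrt_R.aemeasurable).aestronglyMeasurable
      (Lp.memLp u.snd).aestronglyMeasurable
  · filter_upwards [h] with t ht using ht.norm_ringInverse_psdSqrt_apply_le hr _

theorem integrable_R_control (hD : D.Admissible) (u₁ u₂ : D.ControlSpace) :
    Integrable (fun t => ⟪D.R t (control u₁ t), control u₂ t⟫_ℝ) D.vol :=
  (L2.integrable_inner (𝕜 := ℝ) u₁.snd u₂.snd).congr
    ((inner_R_control hD u₁ u₂).mono fun _ h => h.symm)

theorem integral_R_control (hD : D.Admissible) (u₁ u₂ : D.ControlSpace) :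
    ∫ t, ⟪D.R t (control u₁ t), control u₂ t⟫_ℝ ∂D.vol = ⟪u₁.snd, u₂.snd⟫_ℝ := by
  rw [integral_congr_ae (inner_R_control hD u₁ u₂), L2.inner_def]

theorem inner_controlSpace (hD : D.Admissible) (u₁ u₂ : D.ControlSpace) :
    ⟪u₁, u₂⟫_ℝ = ⟪u₁.fst, u₂.fst⟫_ℝ
      + ∫ t, ⟪D.R t (control u₁ t), control u₂ t⟫_ℝ ∂D.vol := by
  rw [integral_R_control hD, WithLp.prod_inner_apply]
  rfl

/-- Finite cost says exactly that `w = R^{1/2} v` is square integrable, since `‖w‖² = ⟨R v, v⟩`. -/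
theorem exists_control_ae_eq (hD : D.Admissible) (z : Euc n) {v : ℝ → Euc m}
    (hv : MemLp v 2 D.vol) (hc : Integrable (fun t => ⟪D.R t (v t), v t⟫_ℝ) D.vol) :
    ∃ u : D.ControlSpace, u.fst = z ∧ control u =ᵐ[D.vol] v := by
  obtain ⟨r, hr, h⟩ := hD.exists_uniformlyPositive
  have hm : AEStronglyMeasurable (fun t => psdSqrt (D.R t) (v t)) D.vol :=
    (ContinuousLinearMap.id ℝ (Euc m →L[ℝ] Euc m)).aestronglyMeasurable_comp₂
      hD.aestronglyMeasurable_psdSqrt_R hv.aestronglyMeasurable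
  have hw : MemLp (fun t => psdSqrt (D.R t) (v t)) 2 D.vol := by
    rw [memLp_two_iff_integrable_sq_norm hm]
    refine hc.congr ?_
    filter_upwards [h] with t ht
    rw [← ht.inner_psdSqrt, real_inner_self_eq_norm_sq]
  refine ⟨WithLp.toLp 2 (z, hw.toLp _), rfl, ?_⟩
  filter_upwards [h, hw.coeFn_toLp] with t ht h1
  change Ring.inverse (psdSqrt (D.R t)) (hw.toLp _ t) = v t
  rw [h1, ringInverse_apply_self (ht.isUnit_psdSqrt hr)]

theorem control_add (u₁ u₂ : D.ControlSpace) :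
    control (u₁ + u₂) =ᵐ[D.vol] fun t => control u₁ t + control u₂ t := by
  filter_upwards [Lp.coeFn_add u₁.snd u₂.snd] with t ht
  change Ring.inverse (psdSqrt (D.R t)) ((u₁.snd + u₂.snd : Lp (Euc m) 2 D.vol) t) = _
  rw [ht, Pi.add_apply, map_add]
  rfl

theorem control_smul (c : ℝ) (u : D.ControlSpace) :
    control (c • u) =ᵐ[D.vol] fun t => c • control u t := by
  filter_upwards [Lp.coeFn_smul c u.snd] with t ht
  change Ring.inverse (psdSqrt (D.R t)) ((c • u.snd : Lp (Euc m) 2 D.vol) t) = _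
  rw [ht, Pi.smul_apply, map_smul]
  rfl

/-! ### The state map -/

/-- Variation of constants for the backward equation. Uniqueness, linearity and the uniform bound
are all read off this formula. -/
theorem Generates.apply_eq (hD : D.Admissible) {X Y : ℝ → Euc n →L[ℝ] Euc n}
    (h : IsFundamentalPair D.F X Y D.t₀ D.T) {z : Euc n} {v : ℝ → Euc m} {l : D.Time → Euc n}
    (hg : D.Generates z v l) (t : D.Time) :
    l t = ((Y t)†) (((X D.T)†) (psdSqrt D.ST z)
      + ∫ τ in t..D.T, ((X τ)†) (((D.H τ)†) (v τ))) := by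
  have h1 := (h.adjoint_solution (hg.isPrimitiveOn hD)).sub_eq D.right_mem t.2
  rw [hg.apply_right, intervalIntegral.integral_neg, ← intervalIntegral.integral_symm,
    IccExtend_of_mem _ _ t.2, sub_eq_iff_eq_add'] at h1
  rw [← h1, h.adjoint_inv_apply t.2]

theorem integral_uIoc_congr_of_ae {E : Type*} [NormedAddCommGroup E] [NormedSpace ℝ E]
    {f g : ℝ → E} (hfg : f =ᵐ[D.vol] g) {s t : ℝ} (hs : s ∈ Icc D.t₀ D.T)
    (ht : t ∈ Icc D.t₀ D.T) : ∫ τ in s..t, f τ = ∫ τ in s..t, g τ := by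
  refine intervalIntegral.integral_congr_ae ?_
  filter_upwards [(ae_restrict_iff' measurableSet_Icc).1 hfg] with x hx hxt
  exact hx (uIcc_subset_Icc hs ht (uIoc_subset_uIcc hxt))

theorem Generates.congr_control {z : Euc n} {v v' : ℝ → Euc m} {l : D.Time → Euc n}
    (hg : D.Generates z v l) (hv : v =ᵐ[D.vol] v') : D.Generates z v' l := by
  refine ⟨hg.control_mem.ae_eq hv, hg.control_cost.congr ?_, hg.continuous, fun t => ?_⟩
  · filter_upwards [hv] with t ht
    rw [ht]
  · rw [hg.equation, integral_uIoc_congr_of_ae _ t.2 D.right_mem]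
    filter_upwards [hv] with t ht
    rw [ht]

theorem Admissible.exists_pair (hD : D.Admissible) :
    ∃ X Y, IsFundamentalPair D.F X Y D.t₀ D.T := by
  obtain ⟨X, Y, h, -⟩ := exists_isFundamentalPair D.t₀_lt_T.le hD.F_int
  exact ⟨X, Y, h⟩

theorem Generates.unique (hD : D.Admissible) {z : Euc n} {v : ℝ → Euc m}
    {l l' : D.Time → Euc n} (hg : D.Generates z v l) (hg' : D.Generates z v l') : l = l' := by
  obtain ⟨X, Y, h⟩ := hD.exists_pair
  ext1 t
  rw [hg.apply_eq hD h, hg'.apply_eq hD h]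

theorem exists_generates (hD : D.Admissible) (z : Euc n) {v : ℝ → Euc m}
    (hv : MemLp v 2 D.vol) (hc : Integrable (fun t => ⟪D.R t (v t), v t⟫_ℝ) D.vol) :
    ∃ l, D.Generates z v l := by
  obtain ⟨X, Y, h⟩ := hD.exists_pair
  have hX := h.adjoint_forward.continuousOn
  have hi : IntegrableOn (fun τ => ((X τ)†) (((D.H τ)†) (v τ))) (Icc D.t₀ D.T) :=
    (hD.H_adjoint_control_int hv).bilin_continuousOn
      (ContinuousLinearMap.id ℝ (Euc n →L[ℝ] Euc n)).flip hX
  have h1 : IsPrimitiveOn (fun s => ((X D.T)†) (psdSqrt D.ST z)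
      + ∫ τ in s..D.T, ((X τ)†) (((D.H τ)†) (v τ))) (fun τ => -((X τ)†) (((D.H τ)†) (v τ)))
      D.t₀ D.T := by
    refine .of_eq_add (x := ((X D.T)†) (psdSqrt D.ST z)) hi.neg D.right_mem fun t _ => ?_
    rw [intervalIntegral.integral_neg, ← intervalIntegral.integral_symm]
  have h2 := h.adjoint_backward.clm_apply h1
  refine ⟨_, Generates.of_isPrimitiveOn hv hc (h2.congr_ae ?_) ?_⟩
  · filter_upwards [ae_restrict_mem measurableSet_Icc] with s hs
    simp [h.adjoint_inv_apply hs]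
    abel
  · simp [h.adjoint_inv_apply D.right_mem]

theorem integrableOn_adjoint_apply_control (hD : D.Admissible) {X : ℝ → Euc n →L[ℝ] Euc n}
    (hX : ContinuousOn (fun t => (X t)†) (Icc D.t₀ D.T)) (u : D.ControlSpace) :
    IntegrableOn (fun τ => ((X τ)†) (((D.H τ)†) (control u τ))) (Icc D.t₀ D.T) :=
  (hD.H_adjoint_control_int (control_mem hD u)).bilin_continuousOn
    (ContinuousLinearMap.id ℝ (Euc n →L[ℝ] Euc n)).flip hX

theorem Generates.eq_add (hD : D.Admissible) {u₁ u₂ : D.ControlSpace} {l l₁ l₂ : D.Time → Euc n}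
    (hg : D.Generates (u₁ + u₂).fst (control (u₁ + u₂)) l)
    (h₁ : D.Generates u₁.fst (control u₁) l₁) (h₂ : D.Generates u₂.fst (control u₂) l₂) :
    l = l₁ + l₂ := by
  obtain ⟨X, Y, h⟩ := hD.exists_pair
  have hi := integrableOn_adjoint_apply_control hD h.adjoint_forward.continuousOn
  ext1 t
  have e1 : (u₁ + u₂).fst = u₁.fst + u₂.fst := rfl
  have e2 : ∫ τ in t..D.T, ((X τ)†) (((D.H τ)†) (control (u₁ + u₂) τ))
      = (∫ τ in t..D.T, ((X τ)†) (((D.H τ)†) (control u₁ τ)))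
        + ∫ τ in t..D.T, ((X τ)†) (((D.H τ)†) (control u₂ τ)) := by
    rw [← intervalIntegral.integral_add ((hi u₁).intervalIntegrable_of_mem t.2 D.right_mem)
      ((hi u₂).intervalIntegrable_of_mem t.2 D.right_mem)]
    refine integral_uIoc_congr_of_ae ?_ t.2 D.right_mem
    filter_upwards [control_add u₁ u₂] with τ hτ
    rw [hτ, map_add, map_add]
  rw [Pi.add_apply, hg.apply_eq hD h, h₁.apply_eq hD h, h₂.apply_eq hD h, e1, e2]
  simp only [map_add]
  abel

theorem Generates.eq_smul (hD : D.Admissible) {c : ℝ} {u : D.ControlSpace}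
    {l l₁ : D.Time → Euc n} (hg : D.Generates (c • u).fst (control (c • u)) l)
    (h₁ : D.Generates u.fst (control u) l₁) : l = c • l₁ := by
  obtain ⟨X, Y, h⟩ := hD.exists_pair
  ext1 t
  have e1 : (c • u).fst = c • u.fst := rfl
  have e2 : ∫ τ in t..D.T, ((X τ)†) (((D.H τ)†) (control (c • u) τ))
      = c • ∫ τ in t..D.T, ((X τ)†) (((D.H τ)†) (control u τ)) := by
    rw [← intervalIntegral.integral_smul]
    refine integral_uIoc_congr_of_ae ?_ t.2 D.right_mem
    filter_upwards [control_smul c u] with τ hτ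
    rw [hτ, map_smul, map_smul]
  rw [Pi.smul_apply, hg.apply_eq hD h, h₁.apply_eq hD h, e1, e2]
  simp only [map_smul, map_add, smul_add]

theorem exists_eLpNorm_control_le (hD : D.Admissible) :
    ∃ C, 0 ≤ C ∧ ∀ u : D.ControlSpace, (eLpNorm (control u) 2 D.vol).toReal ≤ C * ‖u‖ := by
  obtain ⟨r, hr, hR⟩ := hD.exists_uniformlyPositive
  refine ⟨(√r)⁻¹, by positivity, fun u => ?_⟩
  have h1 : eLpNorm (control u) 2 D.vol
      ≤ ENNReal.ofReal (√r)⁻¹ * eLpNorm (u.snd) 2 D.vol :=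
    eLpNorm_le_mul_eLpNorm_of_ae_le_mul (hR.mono fun t ht =>
      ht.norm_ringInverse_psdSqrt_apply_le hr _) 2
  have h2 := ENNReal.toReal_mono (ENNReal.mul_ne_top ENNReal.ofReal_ne_top
    (Lp.memLp u.snd).2.ne) h1
  rw [ENNReal.toReal_mul, ENNReal.toReal_ofReal (by positivity), ← Lp.norm_def] at h2
  refine h2.trans ?_
  gcongr
  exact WithLp.norm_snd_le _ _

theorem exists_norm_generates_le (hD : D.Admissible) :
    ∃ C, ∀ (u : D.ControlSpace) (l : D.Time → Euc n), D.Generates u.fst (control u) l →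
      ∀ t, ‖l t‖ ≤ C * ‖u‖ := by
  obtain ⟨X, Y, h⟩ := hD.exists_pair
  obtain ⟨Cv, hCv, hctrl⟩ := exists_eLpNorm_control_le hD
  have hX := h.adjoint_forward.continuousOn
  obtain ⟨CX, hCX⟩ := isCompact_Icc.exists_bound_of_continuousOn hX
  obtain ⟨CY, hCY⟩ := isCompact_Icc.exists_bound_of_continuousOn h.adjoint_backward.continuousOn
  have hCX0 : 0 ≤ CX := (norm_nonneg _).trans (hCX _ D.left_mem)
  have hCY0 : 0 ≤ CY := (norm_nonneg _).trans (hCY _ D.left_mem)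
  set CH := (eLpNorm (fun τ => (D.H τ)†) 2 D.vol).toReal with hCH
  have hH2 : MemLp (fun τ => (D.H τ)†) 2 D.vol := hD.H_mem.clm_adjoint
  refine ⟨CY * (CX * ‖psdSqrt D.ST‖ + CX * (CH * Cv)), fun u l hu t => ?_⟩
  rw [hu.apply_eq hD h]
  have k1 : ‖((X D.T)†) (psdSqrt D.ST u.fst)‖ ≤ CX * ‖psdSqrt D.ST‖ * ‖u‖ := by
    refine (ContinuousLinearMap.le_opNorm _ _).trans ?_
    rw [mul_assoc]
    have := WithLp.norm_fst_le _ u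
    exact mul_le_mul (hCX _ D.right_mem) ((ContinuousLinearMap.le_opNorm _ _).trans
      (mul_le_mul_of_nonneg_left this (norm_nonneg _))) (norm_nonneg _) hCX0
  have k2 : ‖∫ τ in t..D.T, ((X τ)†) (((D.H τ)†) (control u τ))‖ ≤ CX * (CH * Cv) * ‖u‖ := by
    have hi := integrableOn_adjoint_apply_control hD hX u
    refine (norm_intervalIntegral_le_integral_norm hi t.2 D.right_mem).trans ?_
    calc ∫ τ in Icc D.t₀ D.T, ‖((X τ)†) (((D.H τ)†) (control u τ))‖
        ≤ ∫ τ in Icc D.t₀ D.T, CX * ‖((D.H τ)†) (control u τ)‖ := by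
          refine setIntegral_mono_on hi.norm
            ((hD.H_adjoint_control_int (control_mem hD u)).norm.const_mul _)
            measurableSet_Icc fun τ hτ => ?_
          exact (ContinuousLinearMap.le_opNorm _ _).trans
            (mul_le_mul_of_nonneg_right (hCX τ hτ) (norm_nonneg _))
      _ = CX * ∫ τ in Icc D.t₀ D.T, ‖((D.H τ)†) (control u τ)‖ := integral_const_mul _ _
      _ ≤ CX * (CH * (Cv * ‖u‖)) :=
          mul_le_mul_of_nonneg_left ((integral_norm_clm_apply_le hH2 (control_mem hD u)).trans
            (mul_le_mul_of_nonneg_left (hctrl u) ENNReal.toReal_nonneg)) hCX0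
      _ = _ := by ring
  refine (ContinuousLinearMap.le_opNorm _ _).trans ?_
  rw [mul_assoc CY, add_mul]
  exact mul_le_mul (hCY _ t.2) ((norm_add_le _ _).trans (add_le_add k1 k2)) (norm_nonneg _) hCY0

/-- The map that sends a control to the function that it generates. -/
theorem exists_stateMap (hD : D.Admissible) :
    ∃ Λ : D.ControlSpace →L[ℝ] (D.Time → Euc n),
      (∀ u, D.Generates u.fst (control u) (Λ u)) ∧ ∃ C, ∀ u t, ‖Λ u t‖ ≤ C * ‖u‖ := by
  choose f hf using fun u : D.ControlSpace =>
    exists_generates hD u.fst (control_mem hD u) (integrable_R_control hD u u)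
  obtain ⟨C, hC⟩ := exists_norm_generates_le hD
  -- The target carries the product topology, so continuity is pointwise. The bound uniform in `t`
  -- is kept separately, for the estimate of `stateForm`.
  have hcont : Continuous f := continuous_pi fun t =>
    AddMonoidHomClass.continuous_of_bound
      (AddMonoidHom.mk' (fun u => f u t) fun u₁ u₂ => by
        rw [(hf _).eq_add hD (hf u₁) (hf u₂), Pi.add_apply]) C fun u => hC u _ (hf u) t
  exact ⟨{ toFun := f
           map_add' := fun u₁ u₂ => (hf _).eq_add hD (hf u₁) (hf u₂)
           map_smul' := fun c u => (hf _).eq_smul hD (hf u)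
           cont := hcont }, hf, C, fun u t => hC u _ (hf u) t⟩

/-- The control that generates the kernel section at `t` in direction `p` has the
reproducing property. -/
theorem exists_kernel_control (hD : D.Admissible) {P : ℝ → Euc n →L[ℝ] Euc n}
    (hP : D.IsRiccatiSolution P) {Φ : ℝ → ℝ → Euc n →L[ℝ] Euc n} (hΦ : D.IsEvolution P Φ)
    (t : D.Time) (p : Euc n) :
    ∃ z v, D.Generates z v (fun s : D.Time => D.infoKernel P Φ s t p) ∧
      ∀ z' v' l, D.Generates z' v' l →
        D.costForm (fun s : D.Time => D.infoKernel P Φ s t p) z v l z' v' = ⟪p, l t⟫_ℝ := by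
  obtain ⟨X, Y, h⟩ := exists_closedLoop_pair hD hP
  obtain ⟨hP0, hPprim⟩ := hP.isPrimitiveOn hD
  set S := psdSqrt D.ST with hS
  have hSadj : S† = S := psdSqrt_adjoint _
  set f : ℝ → Euc n := fun s => D.infoKernel P Φ s t p with hf
  have hfeq : ∀ s ∈ Icc D.t₀ D.T, f s = ((Y s)†) (D.kernelCore P X (max s t) (Y t p)) :=
    fun s hs => by
      rw [hf]
      simp only [infoKernel_eq hD hP hΦ h hs t.2, ContinuousLinearMap.comp_apply]
  have hfp := kernelSection_isPrimitiveOn h (fun s hs => hP.adjoint_eq hD hs) hD.HRH_adjoint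
    (kernelCore_isPrimitiveOn hD P h.forward.continuousOn) t.2 hfeq
  set ξ := costateJump P X Y t p f with hξ
  set v : ℝ → Euc m := fun s => (Ring.inverse (D.R s) ∘L D.H s) (ξ s) with hv
  set y := X D.T (Y t p) with hy
  set z := Ring.inverse (D.middle P) (S y) with hz
  have hfT : f D.T = S z := by
    rw [hfeq _ D.right_mem, max_eq_left t.2.2, kernelCore]
    simp only [intervalIntegral.integral_same, add_zero, ContinuousLinearMap.comp_apply]
    rw [h.adjoint_inv_apply D.right_mem]
  -- The terminal condition `z = S (y - P(T) f(T))`, since `f(T) = S z`.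
  have hmid : z + S (P D.T (S z)) = S y := apply_ringInverse (isUnit_middle hD hP) (S y)
  -- `ξ` has a single jump and is otherwise continuous, so it is bounded.
  have hξmem : MemLp ξ ∞ D.vol := by
    have h1 : MemLp (fun s => X s (Y t p)) ∞ D.vol :=
      (h.forward.clm_apply_const (Y t p)).continuousOn.memLp_top_Icc
    have h2 : MemLp (fun s => P s (f s)) ∞ D.vol :=
      (hPprim.clm_apply hfp).continuousOn.memLp_top_Icc
    refine ((h1.indicator (measurableSet_Ioi (a := (t : ℝ)))).sub h2).ae_eq (.of_forall fun s => ?_)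
    simp [ξ, costateJump, indicator]
  have hvmem : MemLp v 2 D.vol :=
    hD.inverse_R_comp_H_mem.clm_apply (p := 2) (q := ∞) hξmem
  have hRv : ∀ᵐ s ∂D.vol, D.R s (v s) = D.H s (ξ s) := by
    filter_upwards [hD.isUnit_R] with s hs using apply_ringInverse hs _
  have hHξ : MemLp (fun s => D.H s (ξ s)) 2 D.vol := hD.H_mem.clm_apply (p := 2) (q := ∞) hξmem
  have hcost : Integrable (fun s => ⟪D.R s (v s), v s⟫_ℝ) D.vol := by
    refine (memLp_one_iff_integrable.1 (hHξ.clm_bilin (p := 2) (q := 2) (innerSL ℝ)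
      hvmem)).congr ?_
    filter_upwards [hRv] with s hs
    rw [hs]
    rfl
  -- As `R v = H ξ`, the control term of the cost form becomes the costate term of
  -- `kernelSection_pairing` with `h = H* v'`.
  have hint (v' : ℝ → Euc m) : ∫ s, ⟪D.R s (v s), v' s⟫_ℝ ∂D.vol
      = ∫ s, ⟪ξ s, ((D.H s)†) (v' s)⟫_ℝ ∂D.vol := by
    refine integral_congr_ae ?_
    filter_upwards [hRv] with s hs
    rw [hs, ContinuousLinearMap.adjoint_inner_right]
  have hgen : D.Generates z v (fun s : D.Time => f s) :=
    Generates.of_isPrimitiveOn hvmem hcost (hfp.congr_deriv fun s => rfl) hfT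
  refine ⟨z, v, hgen, fun z' v' l hl => ?_⟩
  obtain ⟨-, -, hpair⟩ := kernelSection_pairing h hPprim hfp hD.GQG_int t.2
    (hl.isPrimitiveOn hD)
  have e1 : ⟪X D.T (Y t p) - P D.T (f D.T), IccExtend D.t₀_lt_T.le l D.T⟫_ℝ = ⟪z, z'⟫_ℝ := by
    rw [hl.apply_right, hfT, ← hS, ← hSadj, ContinuousLinearMap.adjoint_inner_right, hSadj,
      map_sub, ← hy, ← hmid]
    congr 1
    abel
  rw [e1, hP0, IccExtend_of_mem _ _ D.left_mem, IccExtend_of_mem _ _ t.2] at hpair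
  rw [costForm, hint]
  refine Eq.trans ?_ hpair
  congr 2
  refine setIntegral_congr_fun measurableSet_Icc fun s hs => ?_
  exact congrArg (fun x => ⟪D.GQG s x, IccExtend D.t₀_lt_T.le l s⟫_ℝ)
    (IccExtend_of_mem D.t₀_lt_T.le (fun s : D.Time => f s) hs)

/-! ### Representatives -/

theorem controlCost_eq_norm_sq (hD : D.Admissible) {u : D.ControlSpace} {v : ℝ → Euc m}
    (hv : control u =ᵐ[D.vol] v) : D.controlCost u.fst v = ‖u‖ ^ 2 := by
  rw [← real_inner_self_eq_norm_sq, inner_controlSpace hD, controlCost, real_inner_self_eq_norm_sq]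
  congr 1
  refine integral_congr_ae ?_
  filter_upwards [hv] with t ht
  rw [ht]

variable {Λ : D.ControlSpace →L[ℝ] (D.Time → Euc n)}

theorem Generates.exists_stateMap_eq (hD : D.Admissible)
    (hΛ : ∀ u, D.Generates u.fst (control u) (Λ u)) {z : Euc n} {v : ℝ → Euc m}
    {l : D.Time → Euc n} (hg : D.Generates z v l) :
    ∃ u : D.ControlSpace, u.fst = z ∧ control u =ᵐ[D.vol] v ∧ Λ u = l := by
  obtain ⟨u, hz, hv⟩ := exists_control_ae_eq hD z hg.control_mem hg.control_cost
  refine ⟨u, hz, hv, ((hΛ u).congr_control hv).unique hD ?_⟩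
  rwa [hz]

/-- Any competitor differs from `u` by an element of `ker Λ`, so Pythagoras shows that it costs at
least as much. -/
theorem isRepresentative_of_mem_orthogonal (hD : D.Admissible)
    (hΛ : ∀ u, D.Generates u.fst (control u) (Λ u)) {u : D.ControlSpace} (hu : u ∈ Λ.kerᗮ) :
    D.IsRepresentative u.fst (control u) (Λ u) := by
  refine ⟨hΛ u, fun z' v' hg => ?_⟩
  obtain ⟨u', rfl, hv', hl⟩ := hg.exists_stateMap_eq hD hΛ
  rw [controlCost_eq_norm_sq hD hv', controlCost_eq_norm_sq hD (.refl _ _)]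
  have hk : u' - u ∈ Λ.ker := by
    rw [LinearMap.mem_ker]
    simp [hl]
  have h1 : ⟪u, u' - u⟫_ℝ = 0 := Submodule.inner_left_of_mem_orthogonal hk hu
  have h2 := norm_add_sq_real u (u' - u)
  rw [add_sub_cancel, h1] at h2
  nlinarith [sq_nonneg ‖u' - u‖]

theorem exists_mem_orthogonal_stateMap_eq (u : D.ControlSpace) :
    ∃ u₀ ∈ Λ.kerᗮ, Λ u₀ = Λ u ∧ ‖u‖ ^ 2 = ‖u₀‖ ^ 2 + ‖u - u₀‖ ^ 2 := by
  have hc : CompleteSpace Λ.ker := Λ.isClosed_ker.completeSpace_coe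
  set k : D.ControlSpace := Λ.ker.starProjection u with hk
  have hkm : k ∈ Λ.ker := Submodule.starProjection_apply_mem _ _
  have hkΛ : Λ k = 0 := LinearMap.mem_ker.1 hkm
  have ho : u - k ∈ Λ.kerᗮ := Submodule.sub_starProjection_mem_orthogonal u
  refine ⟨u - k, ho, by rw [map_sub, hkΛ, sub_zero], ?_⟩
  have h1 : ⟪u - k, k⟫_ℝ = 0 := Submodule.inner_left_of_mem_orthogonal hkm ho
  have h2 := norm_add_sq_real (u - k) k
  rw [sub_add_cancel, h1] at h2
  rw [h2, sub_sub_cancel]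
  ring

/-- Projecting a minimiser onto `(ker Λ)ᗮ` keeps the generated function and lowers the cost by `‖u -
u₀‖²`, which minimality forces to vanish. -/
theorem IsRepresentative.exists_mem_orthogonal (hD : D.Admissible)
    (hΛ : ∀ u, D.Generates u.fst (control u) (Λ u)) {z : Euc n} {v : ℝ → Euc m}
    {l : D.Time → Euc n} (hr : D.IsRepresentative z v l) :
    ∃ u ∈ Λ.kerᗮ, u.fst = z ∧ control u =ᵐ[D.vol] v ∧ Λ u = l := by
  obtain ⟨u, rfl, hv, rfl⟩ := hr.1.exists_stateMap_eq hD hΛ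
  obtain ⟨u₀, h₀, hl₀, hn⟩ := exists_mem_orthogonal_stateMap_eq (Λ := Λ) u
  have h1 := hr.2 _ _ (hl₀ ▸ hΛ u₀)
  rw [controlCost_eq_norm_sq hD hv, controlCost_eq_norm_sq hD (.refl _ _)] at h1
  have h2 : ‖u - u₀‖ ^ 2 = 0 := le_antisymm (by linarith) (by positivity)
  have h3 : u = u₀ := by simpa [sub_eq_zero] using h2
  exact ⟨u, h3 ▸ h₀, rfl, hv, rfl⟩

theorem eq_of_mem_orthogonal_of_stateMap_eq {u u' : D.ControlSpace} (hu : u ∈ Λ.kerᗮ)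
    (hu' : u' ∈ Λ.kerᗮ) (h : Λ u = Λ u') : u = u' := by
  have h1 : u - u' ∈ Λ.ker := by
    rw [LinearMap.mem_ker]
    simp [h]
  have h2 : u - u' ∈ Λ.kerᗮ := Submodule.sub_mem _ hu hu'
  have h3 : ⟪u - u', u - u'⟫_ℝ = 0 := Submodule.inner_left_of_mem_orthogonal h1 h2
  exact sub_eq_zero.1 (inner_self_eq_zero.1 h3)

theorem exists_unique_isRepresentative (hD : D.Admissible) (l : D.InfoVector) :
    ∃ z v, D.IsRepresentative z v l.toFun ∧
      ∀ z' v', D.IsRepresentative z' v' l.toFun → z' = z ∧ v' =ᵐ[D.vol] v := by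
  obtain ⟨Λ, hΛ, -⟩ := exists_stateMap hD
  obtain ⟨z, v, hg⟩ := l.exists_generates
  obtain ⟨u, -, -, hl⟩ := hg.exists_stateMap_eq hD hΛ
  obtain ⟨u₀, h₀, hl₀, -⟩ := exists_mem_orthogonal_stateMap_eq (Λ := Λ) u
  have hr := isRepresentative_of_mem_orthogonal hD hΛ h₀
  rw [hl₀, hl] at hr
  refine ⟨_, _, hr, fun z' v' hr' => ?_⟩
  obtain ⟨u', h', rfl, hv', hl'⟩ := hr'.exists_mem_orthogonal hD hΛ
  have : u' = u₀ := eq_of_mem_orthogonal_of_stateMap_eq h' h₀ (by rw [hl', hl₀, hl])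
  subst this
  exact ⟨rfl, hv'.symm⟩

/-! ### The Hilbert space of information vectors -/

theorem InfoVector.ext {l₁ l₂ : D.InfoVector} (h : l₁.toFun = l₂.toFun) : l₁ = l₂ := by
  cases l₁
  cases l₂
  congr

/-- Information vectors correspond to the controls orthogonal to the kernel of the state map. -/
theorem exists_equiv_orthogonal (hD : D.Admissible)
    (hΛ : ∀ u, D.Generates u.fst (control u) (Λ u)) :
    ∃ e : D.InfoVector ≃ Λ.kerᗮ, ∀ l, Λ (e l : D.ControlSpace) = l.toFun := by
  let g : Λ.kerᗮ → D.InfoVector := fun u => ⟨Λ (u : D.ControlSpace), _, _, hΛ u⟩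
  have hg : Function.Bijective g := by
    refine ⟨fun u u' h => Subtype.ext ?_, fun l => ?_⟩
    · exact eq_of_mem_orthogonal_of_stateMap_eq u.2 u'.2 (congrArg InfoVector.toFun h)
    · obtain ⟨z, v, hg⟩ := l.exists_generates
      obtain ⟨u, -, -, hl⟩ := hg.exists_stateMap_eq hD hΛ
      obtain ⟨u₀, h₀, hl₀, -⟩ := exists_mem_orthogonal_stateMap_eq (Λ := Λ) u
      exact ⟨⟨u₀, h₀⟩, InfoVector.ext (hl₀.trans hl)⟩
  refine ⟨(Equiv.ofBijective g hg).symm, fun l => ?_⟩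
  exact congrArg InfoVector.toFun ((Equiv.ofBijective g hg).apply_symm_apply l)

/-- The part `⟨Π₀ l₁(t₀), l₂(t₀)⟩ + ∫ ⟨G Q G* l₁, l₂⟩` of the cost form. -/
def stateForm (D : LinearSystem n m d) (l₁ l₂ : D.Time → Euc n) : ℝ :=
  ⟪D.P₀ (l₁ D.start), l₂ D.start⟫_ℝ
    + ∫ t, ⟪D.GQG t (IccExtend D.t₀_lt_T.le l₁ t), IccExtend D.t₀_lt_T.le l₂ t⟫_ℝ ∂D.vol

theorem integrable_GQG_inner (hD : D.Admissible) {l₁ l₂ : D.Time → Euc n} (h₁ : Continuous l₁)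
    (h₂ : Continuous l₂) : Integrable (fun t => ⟪D.GQG t (IccExtend D.t₀_lt_T.le l₁ t),
      IccExtend D.t₀_lt_T.le l₂ t⟫_ℝ) D.vol :=
  (hD.GQG_int.clm_apply_continuousOn
    (h₁.Icc_extend' (h := D.t₀_lt_T.le)).continuousOn).bilin_continuousOn (innerSL ℝ)
    (h₂.Icc_extend' (h := D.t₀_lt_T.le)).continuousOn

theorem stateForm_add (hD : D.Admissible) {l₁ l₂ l₃ : D.Time → Euc n} (h₁ : Continuous l₁)
    (h₂ : Continuous l₂) (h₃ : Continuous l₃) :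
    D.stateForm (l₁ + l₂) l₃ = D.stateForm l₁ l₃ + D.stateForm l₂ l₃ := by
  have e : ∫ t, ⟪D.GQG t (IccExtend D.t₀_lt_T.le (l₁ + l₂) t),
        IccExtend D.t₀_lt_T.le l₃ t⟫_ℝ ∂D.vol
      = (∫ t, ⟪D.GQG t (IccExtend D.t₀_lt_T.le l₁ t), IccExtend D.t₀_lt_T.le l₃ t⟫_ℝ ∂D.vol)
      + ∫ t, ⟪D.GQG t (IccExtend D.t₀_lt_T.le l₂ t), IccExtend D.t₀_lt_T.le l₃ t⟫_ℝ ∂D.vol := by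
    rw [← integral_add (integrable_GQG_inner hD h₁ h₃) (integrable_GQG_inner hD h₂ h₃)]
    refine integral_congr_ae (.of_forall fun t => ?_)
    simp [IccExtend, inner_add_left]
  simp only [stateForm, e, Pi.add_apply, map_add, inner_add_left]
  ring

theorem stateForm_smul (c : ℝ) (l₁ l₂ : D.Time → Euc n) :
    D.stateForm (c • l₁) l₂ = c * D.stateForm l₁ l₂ := by
  have e : ∫ t, ⟪D.GQG t (IccExtend D.t₀_lt_T.le (c • l₁) t),
        IccExtend D.t₀_lt_T.le l₂ t⟫_ℝ ∂D.vol
      = c * ∫ t, ⟪D.GQG t (IccExtend D.t₀_lt_T.le l₁ t),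
        IccExtend D.t₀_lt_T.le l₂ t⟫_ℝ ∂D.vol := by
    rw [← integral_const_mul]
    refine integral_congr_ae (.of_forall fun t => ?_)
    simp [IccExtend, inner_smul_left]
  simp only [stateForm, e, Pi.smul_apply, map_smul, inner_smul_left, conj_trivial]
  ring

theorem stateForm_comm (hD : D.Admissible) (l₁ l₂ : D.Time → Euc n) :
    D.stateForm l₁ l₂ = D.stateForm l₂ l₁ := by
  rw [stateForm, stateForm]
  congr 1
  · rw [real_inner_comm]
    exact (hD.P₀_pos.isSymmetric _ _).symm
  · refine integral_congr_ae ?_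
    filter_upwards [hD.GQG_pos] with t ht
    rw [real_inner_comm]
    exact (ht.isSymmetric _ _).symm

theorem stateForm_self_nonneg (hD : D.Admissible) (l : D.Time → Euc n) :
    0 ≤ D.stateForm l l := by
  refine add_nonneg (hD.P₀_pos.inner_nonneg_left _) (integral_nonneg_of_ae ?_)
  filter_upwards [hD.GQG_pos] with t ht using ht.inner_nonneg_left _

theorem stateForm_self_le (hD : D.Admissible) {l : D.Time → Euc n} (hl : Continuous l) {C : ℝ}
    (hC : ∀ t, ‖l t‖ ≤ C) :
    D.stateForm l l ≤ (‖D.P₀‖ + ∫ t, ‖D.GQG t‖ ∂D.vol) * C ^ 2 := by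
  have hC0 : 0 ≤ C := (norm_nonneg _).trans (hC D.start)
  have key (A : Euc n →L[ℝ] Euc n) {x : Euc n} (hx : ‖x‖ ≤ C) : ⟪A x, x⟫_ℝ ≤ ‖A‖ * C ^ 2 := by
    refine (real_inner_le_norm _ _).trans ?_
    calc ‖A x‖ * ‖x‖ ≤ (‖A‖ * C) * C :=
          mul_le_mul ((A.le_opNorm x).trans (mul_le_mul_of_nonneg_left hx (norm_nonneg _))) hx
            (norm_nonneg _) (by positivity)
      _ = _ := by ring
  rw [stateForm, add_mul, ← integral_mul_const]
  refine add_le_add (key _ (hC _)) (integral_mono (integrable_GQG_inner hD hl hl)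
    ((Integrable.norm hD.GQG_int).mul_const _) fun t => key _ (hC _))

theorem costForm_eq (hD : D.Admissible) {u₁ u₂ : D.ControlSpace} {v₁ v₂ : ℝ → Euc m}
    (h₁ : control u₁ =ᵐ[D.vol] v₁) (h₂ : control u₂ =ᵐ[D.vol] v₂) (l₁ l₂ : D.Time → Euc n) :
    D.costForm l₁ u₁.fst v₁ l₂ u₂.fst v₂ = ⟪u₁, u₂⟫_ℝ + D.stateForm l₁ l₂ := by
  have e : ∫ t, ⟪D.R t (v₁ t), v₂ t⟫_ℝ ∂D.vol
      = ∫ t, ⟪D.R t (control u₁ t), control u₂ t⟫_ℝ ∂D.vol := by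
    refine integral_congr_ae ?_
    filter_upwards [h₁, h₂] with t e₁ e₂
    rw [e₁, e₂]
  rw [costForm, stateForm, inner_controlSpace hD, e]
  ring

/-- The derivative `-(F* l + H* v)` is square integrable: `l` is bounded and `F ∈ L²`, while `H` is
bounded and `v ∈ L²`. -/
theorem memH1 (hD : D.Admissible) (hF : MemLp D.F 2 D.vol) (hH : MemLp D.H ∞ D.vol)
    (l : D.InfoVector) : D.MemH1 l.toFun := by
  obtain ⟨z, v, hg⟩ := l.exists_generates
  have hp := hg.isPrimitiveOn hD
  refine ⟨fun τ => -(((D.F τ)†) (IccExtend D.t₀_lt_T.le l.toFun τ) + ((D.H τ)†) (v τ)), ?_,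
    fun t => ?_⟩
  · exact ((hF.clm_adjoint.clm_apply (p := 2) (q := ∞) hp.continuousOn.memLp_top_Icc).add
      (hH.clm_adjoint.clm_apply (p := ∞) (q := 2) hg.control_mem)).neg
  · have := hp.eq_add t t.2
    rwa [IccExtend_of_mem _ _ t.2, IccExtend_of_mem _ _ D.left_mem] at this

/-- The reproducing kernel Hilbert space of information vectors. -/
theorem exists_rkhs (hD : D.Admissible) :
    ∃ (_ : NormedAddCommGroup D.InfoVector) (_ : InnerProductSpace ℝ D.InfoVector)
        (_ : CompleteSpace D.InfoVector) (_ : RKHS ℝ D.InfoVector D.Time (Euc n)),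
      (∀ l : D.InfoVector, RKHS.coeCLM ℝ l = l.toFun) ∧
      (∀ (l₁ l₂ : D.InfoVector) (z₁ z₂ : Euc n) (v₁ v₂ : ℝ → Euc m),
        D.IsRepresentative z₁ v₁ l₁.toFun → D.IsRepresentative z₂ v₂ l₂.toFun →
        inner ℝ l₁ l₂ = D.costForm l₁.toFun z₁ v₁ l₂.toFun z₂ v₂) ∧
      (∀ P Φ, D.IsRiccatiSolution P → D.IsEvolution P Φ →
        IsUnit (D.middle P) ∧
        ∀ s t : D.Time, RKHS.kernel D.InfoVector s t = D.infoKernel P Φ s t) := by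
  obtain ⟨Λ, hΛ, C, hC⟩ := exists_stateMap hD
  obtain ⟨e, he⟩ := exists_equiv_orthogonal hD hΛ
  have hcont (u : D.ControlSpace) : Continuous (Λ u) := (hΛ u).continuous
  obtain ⟨i₁, i₂, i₃, L, hL, hinner⟩ := exists_hilbert_structure_of_equiv e
    (fun u₁ u₂ => D.stateForm (Λ (u₁ : D.ControlSpace)) (Λ (u₂ : D.ControlSpace)))
    ((‖D.P₀‖ + ∫ t, ‖D.GQG t‖ ∂D.vol) * C ^ 2)
    (fun x y z => by
      rw [Submodule.coe_add, map_add, stateForm_add hD (hcont _) (hcont _) (hcont _)])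
    (fun c x y => by rw [Submodule.coe_smul, map_smul, stateForm_smul])
    (fun x y => stateForm_comm hD _ _) (fun x => stateForm_self_nonneg hD _)
    (fun x => by
      refine (stateForm_self_le hD (hcont _) (hC x)).trans_eq ?_
      rw [Submodule.coe_norm]
      ring)
  let rk : RKHS ℝ D.InfoVector D.Time (Euc n) :=
    { coeCLM := Λ ∘L Λ.kerᗮ.subtypeL ∘L L
      coeCLM_injective := fun l₁ l₂ h => by
        refine InfoVector.ext ?_
        rw [← he l₁, ← he l₂, ← hL]
        exact h }
  have hcoe (l : D.InfoVector) : RKHS.coeCLM ℝ l = l.toFun := by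
    rw [← he l, ← hL]
    rfl
  have hin (l₁ l₂ : D.InfoVector) (z₁ z₂ : Euc n) (v₁ v₂ : ℝ → Euc m)
      (h₁ : D.IsRepresentative z₁ v₁ l₁.toFun) (h₂ : D.IsRepresentative z₂ v₂ l₂.toFun) :
      inner ℝ l₁ l₂ = D.costForm l₁.toFun z₁ v₁ l₂.toFun z₂ v₂ := by
    obtain ⟨u₁, hu₁, rfl, hv₁, hl₁⟩ := h₁.exists_mem_orthogonal hD hΛ
    obtain ⟨u₂, hu₂, rfl, hv₂, hl₂⟩ := h₂.exists_mem_orthogonal hD hΛ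
    have e₁ : (e l₁ : D.ControlSpace) = u₁ :=
      eq_of_mem_orthogonal_of_stateMap_eq (e l₁).2 hu₁ ((he l₁).trans hl₁.symm)
    have e₂ : (e l₂ : D.ControlSpace) = u₂ :=
      eq_of_mem_orthogonal_of_stateMap_eq (e l₂).2 hu₂ ((he l₂).trans hl₂.symm)
    rw [hinner, costForm_eq hD hv₁ hv₂, Submodule.coe_inner, he, he, e₁, e₂]
  refine ⟨i₁, i₂, i₃, rk, hcoe, hin, fun P Φ hP hΦ => ⟨isUnit_middle hD hP, fun s t => ?_⟩⟩
  ext1 p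
  obtain ⟨z, v, hg, hrep⟩ := exists_kernel_control hD hP hΦ t p
  let k : D.InfoVector := ⟨fun s => D.infoKernel P Φ s t p, z, v, hg⟩
  have hk : D.IsRepresentative z v k.toFun := by
    obtain ⟨u, rfl, hv, hl⟩ := hg.exists_stateMap_eq hD hΛ
    -- For `w ∈ ker Λ` the generated function is `0`, so the reproducing identity reduces to `⟨u, w⟩
    -- = ⟨p, 0⟩ = 0`.
    have hu : u ∈ Λ.kerᗮ := by
      rw [Submodule.mem_orthogonal']
      intro w hw
      have hw0 : Λ w = 0 := LinearMap.mem_ker.1 hw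
      have h1 := hrep _ _ _ (hΛ w)
      have h2 := costForm_eq hD hv (.refl _ (control w)) (fun s : D.Time => D.infoKernel P Φ s t p)
        (Λ w)
      rw [h1, hw0] at h2
      have h3 : D.stateForm (fun s : D.Time => D.infoKernel P Φ s t p) 0 = 0 := by
        simp [stateForm, IccExtend]
      rw [h3] at h2
      simpa using h2.symm
    have h4 := isRepresentative_of_mem_orthogonal hD hΛ hu
    rw [hl] at h4
    refine ⟨hg, fun z' v' hg' => ?_⟩
    have h5 := h4.2 z' v' hg'
    rwa [controlCost_eq_norm_sq hD (.refl _ _), ← controlCost_eq_norm_sq hD hv] at h5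
  -- Both sides have the same inner product `⟨p, l t⟩` with every information vector `l`.
  have hker : RKHS.kerFun D.InfoVector t p = k := by
    refine ext_inner_right ℝ fun l => ?_
    obtain ⟨z', v', hr', -⟩ := exists_unique_isRepresentative hD l
    rw [RKHS.kerFun_inner, hin k l _ _ _ _ hk hr', hrep _ _ _ hr'.1]
    congr 1
    exact congrFun (hcoe l) t
  rw [← RKHS.kerFun_apply, hker]
  exact congrFun (hcoe k) s

end LinearSystem

theorem mainTheorem3 {n m d : ℕ} (D : LinearSystem n m d) (hD : D.Admissible) :
    -- every information vector has a representative, unique up to almost everywhere equality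
    (∀ l : D.InfoVector, ∃ z v, D.IsRepresentative z v l.toFun ∧
      ∀ z' v', D.IsRepresentative z' v' l.toFun → z' = z ∧ v' =ᵐ[D.vol] v) ∧
    -- the Riccati equation and the evolution equation have solutions on the whole interval
    (∃ P, D.IsRiccatiSolution P ∧ ∃ Φ, D.IsEvolution P Φ) ∧
    (∀ P, D.IsRiccatiSolution P → ∃ Φ, D.IsEvolution P Φ) ∧
    -- the information vectors form a reproducing kernel Hilbert space for the pointwise
    -- operations and the inner product derived from the cost, and its kernel is `Λ`
    (∃ (_ : NormedAddCommGroup D.InfoVector) (_ : InnerProductSpace ℝ D.InfoVector)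
        (_ : CompleteSpace D.InfoVector) (_ : RKHS ℝ D.InfoVector D.Time (Euc n)),
      (∀ l : D.InfoVector, RKHS.coeCLM ℝ l = l.toFun) ∧
      (∀ (l₁ l₂ : D.InfoVector) (z₁ z₂ : Euc n) (v₁ v₂ : ℝ → Euc m),
        D.IsRepresentative z₁ v₁ l₁.toFun → D.IsRepresentative z₂ v₂ l₂.toFun →
        inner ℝ l₁ l₂ = D.costForm l₁.toFun z₁ v₁ l₂.toFun z₂ v₂) ∧
      (∀ P Φ, D.IsRiccatiSolution P → D.IsEvolution P Φ →
        IsUnit (D.middle P) ∧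
        ∀ s t : D.Time, RKHS.kernel D.InfoVector s t = D.infoKernel P Φ s t)) ∧
    -- under the square integrability of `F` and the boundedness of `H`, they belong to `H¹`
    (MemLp D.F 2 D.vol → MemLp D.H ∞ D.vol → ∀ l : D.InfoVector, D.MemH1 l.toFun) := by
  exact ⟨LinearSystem.exists_unique_isRepresentative hD,
    (LinearSystem.exists_isRiccatiSolution hD).imp fun _ hP =>
      ⟨hP, LinearSystem.exists_isEvolution hD hP⟩,
    fun _ hP => LinearSystem.exists_isEvolution hD hP,
    LinearSystem.exists_rkhs hD, LinearSystem.memH1 hD⟩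

end
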